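/- Let $\Sigma=\{0,1\}$, and let a pair of strings be given to, or output by, a Turing machine as the two strings separated by a delimiter. For a total function $\sigma:\Sigma^*\times\Sigma^*\to\Sigma^*$ we say: - $\sigma$ is *honest* if there is a polynomial $q$ such that every $z\in\mathrm{image}(\sigma)$ has some $(a,b)$ with $\sigma(a,b)=z$ and $|a|+|b|\le q(|z|)$; - $\sigma$ is *invertible* if there is a total polynomial-time computable $g:\Sigma^*\to\Sigma^*\times\Sigma^*$ with $\sigma(g(z))=z$ for all $z\in\mathrm{image}(\sigma)$; - $\sigma$ is *one-way* if it is honest, polynomial-time computable, and not invertible; - $\sigma$ is *s-honest* if there is a polynomial $q$ such that whenever $\sigma(a,b)=z$, there is $b'$ with $|b'|\le q(|z|+|a|)$ and $\sigma(a,b')=z$, and there is $a'$ with $|a'|\le q(|z|+|b|)$ and $\sigma(a',b)=z$; - $\sigma$ is *invertible with respect to the first argument* if there is a total polynomial-time computable $g_1:\Sigma^*\times\Sigma^*\to\Sigma^*$ such that $\sigma(a,b)=z$ implies $\sigma(a,g_1(a,z))=z$; it is *invertible with respect to the second argument* if there is a total polynomial-time computable $g_2:\Sigma^*\times\Sigma^*\to\Sigma^*$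 such that $\sigma(a,b)=z$ implies $\sigma(g_2(b,z),b)=z$; - $\sigma$ is *strongly one-way* if it is s-honest, polynomial-time computable, and invertible with respect to neither argument. **Theorem.** If $\mathrm{P}\neq\mathrm{NP}$, then there exists a total, honest function $\sigma:\Sigma^*\times\Sigma^*\to\Sigma^*$ that is strongly one-way but not a one-way function; moreover, $\sigma$ is invertible. -/

import Mathlib

namespace StrongOneWay

/-- Strings over the binary alphabet `{0,1}`. -/
abbrev Str := List Bool

/-- How a pair of strings is written on a tape: the two strings, separated by the
extra symbol `none`. -/
def encodePair (p : Str × Str) : List (Option Bool) :=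
  p.1.map some ++ none :: p.2.map some

theorem encodePair_injective : Function.Injective encodePair := by
  have hsome : Function.Injective (some : Bool → Option Bool) := Option.some_injective _
  rintro ⟨a, b⟩ ⟨c, d⟩ h
  induction a generalizing c with
  | nil =>
    cases c with
    | nil =>
      simp only [encodePair, List.map_nil, List.nil_append, List.cons.injEq, true_and] at h
      rw [List.map_injective_iff.2 hsome h]
    | cons y c => simp [encodePair] at h
  | cons x a ih =>
    cases c with
    | nil => simp [encodePair] at h
    | cons y c =>
      simp only [encodePair, List.map_cons, List.cons_append, List.cons.injEq,
        Option.some.injEq] at h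
      obtain ⟨hx, h⟩ := h
      have := ih c h
      simp only [Prod.mk.injEq] at this ⊢
      exact ⟨by rw [hx, this.1], this.2⟩

/-- `f` is computed by a deterministic (multi-stack) Turing machine whose number of steps is
bounded by a polynomial in the length of the encoded input. -/
def PolyTime {α β A B : Type} (ea : α → List A) (eb : β → List B) (f : α → β) : Prop :=
  Nonempty (Turing.TM2ComputableInPolyTime ea eb f)

/-- The class P: languages over `{0,1}` with a polynomial-time computable
characteristic function. -/
def P : Set (Language Bool) :=
  {L | ∃ f : Str → Bool, PolyTime id Computability.encodeBool f ∧ ∀ x, x ∈ L ↔ f x = true}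

/-- The class NP: languages over `{0,1}` whose members are those strings that have a witness
of polynomially bounded length accepted by a polynomial-time verifier. -/
def NP : Set (Language Bool) :=
  {L | ∃ (V : Str × Str → Bool) (p : Polynomial ℕ),
    PolyTime encodePair Computability.encodeBool V ∧
    ∀ x, x ∈ L ↔ ∃ w : Str, w.length ≤ p.eval x.length ∧ V (x, w) = true}

/-- A total 2-ary function is polynomial-time computable. -/
def PolyTimeComputable (σ : Str → Str → Str) : Prop :=
  PolyTime encodePair id (fun p : Str × Str => σ p.1 p.2)

/-- Every image element has a preimage of length polynomial in its own length. -/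
def Honest (ρ : Str → Str → Str) : Prop :=
  ∃ q : Polynomial ℕ, ∀ z, (∃ a b, ρ a b = z) →
    ∃ a b, a.length + b.length ≤ q.eval z.length ∧ ρ a b = z

/-- Some polynomial-time computable function maps each image element to a preimage of it. -/
def Invertible (ρ : Str → Str → Str) : Prop :=
  ∃ g : Str → Str × Str, PolyTime id encodePair g ∧
    ∀ z, (∃ a b, ρ a b = z) → ρ (g z).1 (g z).2 = z

/-- One-way: honest, polynomial-time computable and noninvertible. -/
def OneWay (ρ : Str → Str → Str) : Prop :=
  Honest ρ ∧ PolyTimeComputable ρ ∧ ¬ Invertible ρ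

/-- s-honesty: if an image element has a preimage with a given argument, then it has one whose
other argument is of length polynomial in the lengths of the image element and
of the given argument. -/
def SHonest (σ : Str → Str → Str) : Prop :=
  ∃ q : Polynomial ℕ,
    (∀ z a, (∃ b, σ a b = z) → ∃ b', b'.length ≤ q.eval (z.length + a.length) ∧ σ a b' = z) ∧
    (∀ z b, (∃ a, σ a b = z) → ∃ a', a'.length ≤ q.eval (z.length + b.length) ∧ σ a' b = z)

/-- Invertible with respect to the first argument: a suitable second argument can be computed
in polynomial time from the first argument and the image element. -/
def InvertibleFst (σ : Str → Str → Str) : Prop :=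
  ∃ g : Str × Str → Str, PolyTime encodePair id g ∧
    ∀ z a b, σ a b = z → σ a (g (a, z)) = z

/-- Invertible with respect to the second argument: a suitable first argument can be computed
in polynomial time from the second argument and the image element. -/
def InvertibleSnd (σ : Str → Str → Str) : Prop :=
  ∃ g : Str × Str → Str, PolyTime encodePair id g ∧
    ∀ z a b, σ a b = z → σ (g (b, z)) b = z

/-- Strongly noninvertible: invertible with respect to neither argument. -/
def StronglyNoninvertible (σ : Str → Str → Str) : Prop :=
  ¬ InvertibleFst σ ∧ ¬ InvertibleSnd σ

/-- Strongly one-way: s-honest, polynomial-time computable and strongly noninvertible. -/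
def StronglyOneWay (σ : Str → Str → Str) : Prop :=
  SHonest σ ∧ PolyTimeComputable σ ∧ StronglyNoninvertible σ

end StrongOneWay

/-! Take a language in NP but not in P, with verifier `V` and witness bound `p`. The function
`checkPair V` returns a single bit: whether its two arguments together hold an instance `x` and a
witness `w` accepted by `V`. Since it has at most two values, a fixed table with one preimage per
attained value gives both honesty and an inverter (`honest_checkPair`, `invertible_checkPair`).
Inversion becomes hard once one argument is prescribed: the string `holdInstance (p.eval x.length)
x` can be written down from `x` alone, and its partners supply exactly the witnesses of length at
most `p.eval x.length` (`decode_holdInstance`, `exists_decode_holdInstance`). An inverter for the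
value `[true]` would find an accepted witness whenever there is one, and so put the language in P
(`mem_P_of_invertibleFst`).

The coding is chosen for symmetry and s-honesty. The two strings are read in parallel from their
ends. Their first symbols must differ, and the string that shows 0 carries the instance: read
backwards it is `0`, a block of zeros, `1`, then `x` reversed. Opposite the block of zeros, the
partner shows padding zeros, a mark `1` and the witness reversed; its remaining symbols are ignored.
As the roles are announced by the strings themselves, the function is commutative (`decode_comm`),
so one argument suffices for strong noninvertibility. Decoding succeeds only for equal lengths, and
a failure has the value `[false]`, which an empty second argument also gives; hence s-honesty
(`sHonest_checkPair`).

What remains is polynomial time on multi-stack machines: program fragments are run on chosen stacks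
and chained, which yields composition (`PolyTime.comp`), pairing (`PolyTime.pair`), finite-state
transducers (`PolyTime.of_transduce`), unary evaluation of polynomials (`polyTime_pair_unary`) and
the decoder (`polyTime_decode`). -/

namespace StrongOneWay

open Turing TM2

/-! ### Program fragments over a fixed collection of stacks -/

section Steps

variable {K : Type} [DecidableEq K] {Γ : K → Type} {Λ Λ' S : Type}

/-- `Steps m n c c'`: the program `m` goes from `c` to `c'` in exactly `n` steps. -/
def Steps (m : Λ → Stmt Γ Λ S) : ℕ → Cfg Γ Λ S → Cfg Γ Λ S → Prop
  | 0, c, c' => c = c'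
  | n + 1, c, c' => ∃ c₁, step m c = some c₁ ∧ Steps m n c₁ c'

theorem steps_iff_iterate (m : Λ → Stmt Γ Λ S) (n : ℕ) (c c' : Cfg Γ Λ S) :
    Steps m n c c' ↔ (flip bind (step m))^[n] (some c) = some c' := by
  induction n generalizing c with
  | zero => simp [Steps]
  | succ n ih =>
    have hnone : ∀ n, (flip bind (step m))^[n] none = none := by
      intro n
      induction n with
      | zero => rfl
      | succ n ih => rw [Function.iterate_succ_apply]; exact ih
    rw [Function.iterate_succ_apply]
    change _ ↔ (flip bind (step m))^[n] (step m c) = some c'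
    simp only [Steps]
    cases h : step m c with
    | none => rw [hnone]; simp
    | some c₁ => simp [ih]

theorem Steps.trans {m : Λ → Stmt Γ Λ S} {n₁ n₂ : ℕ} {c₁ c₂ c₃ : Cfg Γ Λ S}
    (h₁ : Steps m n₁ c₁ c₂) (h₂ : Steps m n₂ c₂ c₃) : Steps m (n₁ + n₂) c₁ c₃ := by
  rw [steps_iff_iterate] at *
  rw [Nat.add_comm, Function.iterate_add_apply, h₁, h₂]

/-- Rename the labels of a statement along `ι`, and continue at `e` instead of halting. -/
def redirect (ι : Λ → Λ') (e : Option Λ') : Stmt Γ Λ S → Stmt Γ Λ' S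
  | .push k f q => .push k f (redirect ι e q)
  | .peek k f q => .peek k f (redirect ι e q)
  | .pop k f q => .pop k f (redirect ι e q)
  | .load a q => .load a (redirect ι e q)
  | .branch p q₁ q₂ => .branch p (redirect ι e q₁) (redirect ι e q₂)
  | .goto l => .goto fun v => ι (l v)
  | .halt => match e with
    | none => .halt
    | some l => .goto fun _ => l

/-- The label counterpart of `redirect`. -/
def redirectLabel (ι : Λ → Λ') (e : Option Λ') : Option Λ → Option Λ'
  | none => e
  | some l => some (ι l)

theorem stepAux_redirect (ι : Λ → Λ') (e : Option Λ') (q : Stmt Γ Λ S) (v : S)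
    (T : ∀ k, List (Γ k)) :
    stepAux (redirect ι e q) v T =
      ⟨redirectLabel ι e (stepAux q v T).l, (stepAux q v T).var, (stepAux q v T).stk⟩ := by
  induction q generalizing v T with
  | push k f q ih => simp [redirect, ih]
  | peek k f q ih => simp [redirect, ih]
  | pop k f q ih => simp [redirect, ih]
  | load a q ih => simp [redirect, ih]
  | branch p q₁ q₂ ih₁ ih₂ => cases h : p v <;> simp [redirect, h, ih₁, ih₂]
  | goto l => simp [redirect, redirectLabel]
  | halt => cases e <;> simp [redirect, redirectLabel]

/-- Relabelling is a simulation step for step, in which the halting label of the old program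
corresponds to the exit `e`. -/
theorem Steps.redirect {m : Λ → Stmt Γ Λ S} {m' : Λ' → Stmt Γ Λ' S} {ι : Λ → Λ'}
    {e : Option Λ'} (hm : ∀ l, m' (ι l) = StrongOneWay.redirect ι e (m l)) {n : ℕ}
    {c c' : Cfg Γ Λ S} (h : Steps m n c c') :
    Steps m' n ⟨redirectLabel ι e c.l, c.var, c.stk⟩ ⟨redirectLabel ι e c'.l, c'.var, c'.stk⟩ := by
  induction n generalizing c with
  | zero => cases h; rfl
  | succ n ih =>
    obtain ⟨c₁, h₁, h₂⟩ := h
    refine ⟨_, ?_, ih h₂⟩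
    obtain ⟨l, v, T⟩ := c
    cases l with
    | none => simp at h₁
    | some l =>
      simp only [step, Option.some.injEq] at h₁
      simp [redirectLabel, hm, stepAux_redirect, ← h₁]

/-- The greatest number of symbols a statement may push. -/
def pushes : Stmt Γ Λ S → ℕ
  | .push _ _ q => pushes q + 1
  | .peek _ _ q => pushes q
  | .pop _ _ q => pushes q
  | .load _ q => pushes q
  | .branch _ q₁ q₂ => max (pushes q₁) (pushes q₂)
  | .goto _ => 0
  | .halt => 0

theorem length_stepAux_le (q : Stmt Γ Λ S) (v : S) (T : ∀ k, List (Γ k)) (k : K) :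
    ((stepAux q v T).stk k).length ≤ (T k).length + pushes q := by
  induction q generalizing v T with
  | push j f q ih =>
    refine (ih _ _).trans ?_
    by_cases h : k = j
    · subst h; simp [pushes]; omega
    · simp [pushes, h]
  | peek j f q ih => exact ih _ _
  | pop j f q ih =>
    refine (ih _ _).trans ?_
    by_cases h : k = j
    · subst h; simp [pushes]
    · simp [pushes, h]
  | load a q ih => exact ih _ _
  | branch p q₁ q₂ ih₁ ih₂ =>
    have := ih₁ v T
    have := ih₂ v T
    cases h : p v <;> simp only [stepAux, h, cond, pushes] <;> omega
  | goto l => simp [pushes]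
  | halt => simp [pushes]

/-- One step executes one statement, which pushes boundedly many symbols. This is why the output of
a polynomial-time machine has polynomial length. -/
theorem Steps.length_le {m : Λ → Stmt Γ Λ S} {B : ℕ} (hB : ∀ l, pushes (m l) ≤ B) {n : ℕ}
    {c c' : Cfg Γ Λ S} (h : Steps m n c c') (k : K) :
    (c'.stk k).length ≤ (c.stk k).length + n * B := by
  induction n generalizing c with
  | zero => cases h; simp
  | succ n ih =>
    obtain ⟨c₁, h₁, h₂⟩ := h
    have := ih h₂
    obtain ⟨l, v, T⟩ := c
    cases l with
    | none => simp at h₁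
    | some l =>
      simp only [step, Option.some.injEq] at h₁
      have h3 := length_stepAux_le (m l) v T k
      rw [h₁] at h3
      have := hB l
      simp only
      linarith [Nat.succ_mul n B]

end Steps

/-! ### Running a program inside a machine with more stacks and a larger state -/

section Lift

variable {K K' : Type} [DecidableEq K] [DecidableEq K'] {Γ : K → Type} {Λ S S' : Type}
  (ι : K' → K) (get : S → S') (put : S' → S → S)

/-- Run a statement on the stacks in the range of `ι`
and on the part of the state seen through `get` and `put`. -/
def liftStmt : Stmt (fun k => Γ (ι k)) Λ S' → Stmt Γ Λ S
  | .push k f q => .push (ι k) (fun v => f (get v)) (liftStmt q)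
  | .peek k f q => .peek (ι k) (fun v o => put (f (get v) o) v) (liftStmt q)
  | .pop k f q => .pop (ι k) (fun v o => put (f (get v) o) v) (liftStmt q)
  | .load a q => .load (fun v => put (a (get v)) v) (liftStmt q)
  | .branch p q₁ q₂ => .branch (fun v => p (get v)) (liftStmt q₁) (liftStmt q₂)
  | .goto l => .goto fun v => l (get v)
  | .halt => .halt

variable {ι get put} (hι : Function.Injective ι) (hgp : ∀ v s, get (put v s) = v)
  (hpg : ∀ s, put (get s) s = s) (hpp : ∀ v w s, put v (put w s) = put v s)

include hι hgp hpg hpp in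
-- The laws for `get` and `put` say that the small state is an independent component of the large
-- one; injectivity of `ι` keeps an update of one small stack from touching another.
theorem stepAux_liftStmt (q : Stmt (fun k => Γ (ι k)) Λ S') (s : S) (T : ∀ k, List (Γ k)) :
    ∃ T', stepAux (liftStmt ι get put q) s T =
        ⟨(stepAux q (get s) fun k => T (ι k)).l,
          put (stepAux q (get s) fun k => T (ι k)).var s, T'⟩ ∧
      (fun k => T' (ι k)) = (stepAux q (get s) fun k => T (ι k)).stk ∧
      ∀ k, k ∉ Set.range ι → T' k = T k := by
  induction q generalizing s T with
  | push j f q ih =>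
    obtain ⟨T', h₁, h₂, h₃⟩ := ih s (Function.update T (ι j) (f (get s) :: T (ι j)))
    rw [Function.update_comp_eq_of_injective' T hι] at h₁ h₂
    refine ⟨T', h₁, h₂, fun k hk => (h₃ k hk).trans ?_⟩
    rw [Function.update_of_ne]
    rintro rfl
    exact hk ⟨j, rfl⟩
  | peek j f q ih =>
    obtain ⟨T', h₁, h₂, h₃⟩ := ih (put (f (get s) (T (ι j)).head?) s) T
    rw [hgp, hpp] at h₁
    rw [hgp] at h₂
    exact ⟨T', h₁, h₂, h₃⟩
  | pop j f q ih =>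
    obtain ⟨T', h₁, h₂, h₃⟩ := ih (put (f (get s) (T (ι j)).head?) s)
      (Function.update T (ι j) (T (ι j)).tail)
    rw [Function.update_comp_eq_of_injective' T hι] at h₁ h₂
    rw [hgp, hpp] at h₁
    rw [hgp] at h₂
    refine ⟨T', h₁, h₂, fun k hk => (h₃ k hk).trans ?_⟩
    rw [Function.update_of_ne]
    rintro rfl
    exact hk ⟨j, rfl⟩
  | load a q ih =>
    obtain ⟨T', h₁, h₂, h₃⟩ := ih (put (a (get s)) s) T
    rw [hgp, hpp] at h₁
    rw [hgp] at h₂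
    exact ⟨T', h₁, h₂, h₃⟩
  | branch p q₁ q₂ ih₁ ih₂ =>
    cases h : p (get s)
    · simpa [liftStmt, h] using ih₂ s T
    · simpa [liftStmt, h] using ih₁ s T
  | goto l => exact ⟨T, by simp [liftStmt, hpg], rfl, fun _ _ => rfl⟩
  | halt => exact ⟨T, by simp [liftStmt, hpg], rfl, fun _ _ => rfl⟩

include hι hgp hpg hpp in
theorem Steps.lift {m : Λ → Stmt (fun k => Γ (ι k)) Λ S'} {n : ℕ}
    {c c' : Cfg (fun k => Γ (ι k)) Λ S'} (h : Steps m n c c') (s : S) (T : ∀ k, List (Γ k))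
    (hs : get s = c.var) (hT : (fun k => T (ι k)) = c.stk) :
    ∃ T', Steps (fun l => liftStmt ι get put (m l)) n ⟨c.l, s, T⟩ ⟨c'.l, put c'.var s, T'⟩ ∧
      (fun k => T' (ι k)) = c'.stk ∧ ∀ k, k ∉ Set.range ι → T' k = T k := by
  induction n generalizing c s T with
  | zero => cases h; exact ⟨T, by rw [← hs, hpg]; rfl, hT, fun _ _ => rfl⟩
  | succ n ih =>
    obtain ⟨c₁, h₁, h₂⟩ := h
    obtain ⟨l, v, U⟩ := c
    simp only at hs hT
    subst hs hT
    cases l with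
    | none => simp at h₁
    | some l =>
      simp only [step, Option.some.injEq] at h₁
      obtain ⟨T₁, e₁, e₂, e₃⟩ := stepAux_liftStmt hι hgp hpg hpp (m l) s T
      rw [h₁] at e₁ e₂
      obtain ⟨T', f₁, f₂, f₃⟩ := ih h₂ (put c₁.var s) T₁ (hgp _ _) e₂
      rw [hpp] at f₁
      exact ⟨T', ⟨_, by simp [e₁], f₁⟩, f₂, fun k hk => (f₃ k hk).trans (e₃ k hk)⟩

end Lift

/-- A program with finitely many labels and with an entry point. It exits by halting. -/
structure Frag {K : Type} (Γ : K → Type) (S : Type) where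
  /-- the labels -/
  Λ : Type
  /-- there are finitely many labels -/
  fin : Fintype Λ
  /-- the entry point -/
  main : Λ
  /-- the code -/
  code : Λ → Stmt Γ Λ S

/-- Stack contents with a single nonempty stack. -/
def single {K : Type} [DecidableEq K] {Γ : K → Type} (k : K) (l : List (Γ k)) (j : K) :
    List (Γ j) :=
  Function.update (fun _ => []) k l j

namespace Frag

section

variable {K : Type} [DecidableEq K] {Γ : K → Type} {S : Type}

/-- The fragment leads from one state and stack contents to another in at most `t` steps. -/
def Runs (F : Frag Γ S) (v : S) (T : ∀ k, List (Γ k)) (v' : S) (T' : ∀ k, List (Γ k))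
    (t : ℕ) : Prop :=
  ∃ n ≤ t, Steps F.code n ⟨some F.main, v, T⟩ ⟨none, v', T'⟩

theorem Runs.mono {F : Frag Γ S} {v v' : S} {T T' : ∀ k, List (Γ k)} {t t' : ℕ}
    (h : F.Runs v T v' T' t) (ht : t ≤ t') : F.Runs v T v' T' t' := by
  obtain ⟨n, hn, h⟩ := h
  exact ⟨n, hn.trans ht, h⟩

theorem Runs.congr {F : Frag Γ S} {v v' : S} {T T' T'' : ∀ k, List (Γ k)} {t t' : ℕ}
    (h : F.Runs v T v' T' t) (hT : ∀ k, T' k = T'' k) (ht : t ≤ t') : F.Runs v T v' T'' t' :=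
  funext hT ▸ h.mono ht

/-- A fragment with a single label. -/
def rep (q : Stmt Γ Unit S) : Frag Γ S := ⟨Unit, inferInstance, (), fun _ => q⟩

theorem runs_rep_halt {q : Stmt Γ Unit S} {v v' : S} {T T' : ∀ k, List (Γ k)}
    (h : stepAux q v T = ⟨none, v', T'⟩) : (rep q).Runs v T v' T' 1 :=
  ⟨1, le_rfl, _, by simp [rep, h], rfl⟩

theorem runs_rep_goto {q : Stmt Γ Unit S} {v v₁ v' : S} {T T₁ T' : ∀ k, List (Γ k)} {t : ℕ}
    (h : stepAux q v T = ⟨some (), v₁, T₁⟩) (h' : (rep q).Runs v₁ T₁ v' T' t) :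
    (rep q).Runs v T v' T' (t + 1) := by
  obtain ⟨n, hn, h'⟩ := h'
  exact ⟨n + 1, by omega, _, by simp [rep, h], h'⟩

/-- Sequential composition. -/
def seq (F G : Frag Γ S) : Frag Γ S where
  Λ := F.Λ ⊕ G.Λ
  fin := have := F.fin; have := G.fin; inferInstance
  main := .inl F.main
  code := Sum.elim (fun l => redirect .inl (some (.inr G.main)) (F.code l))
    fun l => redirect .inr none (G.code l)

theorem Runs.seq {F G : Frag Γ S} {v v₁ v' : S} {T T₁ T' : ∀ k, List (Γ k)} {t t' : ℕ}
    (h : F.Runs v T v₁ T₁ t) (h' : G.Runs v₁ T₁ v' T' t') :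
    (F.seq G).Runs v T v' T' (t + t') := by
  obtain ⟨n, hn, h⟩ := h
  obtain ⟨n', hn', h'⟩ := h'
  refine ⟨n + n', by omega, Steps.trans (h.redirect (m' := (F.seq G).code) (ι := .inl)
    (e := some (.inr G.main)) fun _ => rfl)
    (h'.redirect (m' := (F.seq G).code) (ι := .inr) (e := none) fun _ => rfl)⟩

/-- Run `q` (where continuing is written as a jump) and then `F`, until `q` halts. -/
def loop (q : Stmt Γ Unit S) (F : Frag Γ S) : Frag Γ S where
  Λ := Option F.Λ
  fin := have := F.fin; inferInstance
  main := none
  code := fun l => l.elim (redirect (fun _ => some F.main) none q)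
    fun l => redirect some (some none) (F.code l)

theorem runs_loop_halt {q : Stmt Γ Unit S} {F : Frag Γ S} {v v' : S} {T T' : ∀ k, List (Γ k)}
    (h : stepAux q v T = ⟨none, v', T'⟩) : (loop q F).Runs v T v' T' 1 :=
  ⟨1, le_rfl, _, by simp [loop, stepAux_redirect, h, redirectLabel], rfl⟩

theorem runs_loop_goto {q : Stmt Γ Unit S} {F : Frag Γ S} {v v₁ v₂ v' : S}
    {T T₁ T₂ T' : ∀ k, List (Γ k)} {t t' : ℕ} (h : stepAux q v T = ⟨some (), v₁, T₁⟩)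
    (h₁ : F.Runs v₁ T₁ v₂ T₂ t) (h₂ : (loop q F).Runs v₂ T₂ v' T' t') :
    (loop q F).Runs v T v' T' (t + t' + 1) := by
  obtain ⟨n, hn, h₁⟩ := h₁
  obtain ⟨n', hn', h₂⟩ := h₂
  refine ⟨n + n' + 1, by omega, _, by simp [loop, stepAux_redirect, h, redirectLabel]; rfl, ?_⟩
  exact (h₁.redirect (m' := (loop q F).code) (ι := some) (e := some none)
    fun _ => rfl).trans h₂

end

section

variable {K K' : Type} [DecidableEq K] [DecidableEq K'] {Γ : K → Type} {S S' : Type}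

/-- Run a fragment on the stacks in the range of `ι`. -/
def lift (ι : K' → K) (get : S → S') (put : S' → S → S) (F : Frag (fun k => Γ (ι k)) S') :
    Frag Γ S :=
  ⟨F.Λ, F.fin, F.main, fun l => liftStmt ι get put (F.code l)⟩

theorem Runs.lift {ι : K' → K} {get : S → S'} {put : S' → S → S}
    {F : Frag (fun k => Γ (ι k)) S'} (hι : Function.Injective ι)
    (hgp : ∀ v s, get (put v s) = v) (hpg : ∀ s, put (get s) s = s)
    (hpp : ∀ v w s, put v (put w s) = put v s) {v : S} {w : S'} {T T' : ∀ k, List (Γ k)}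
    {U U' : ∀ k, List (Γ (ι k))} {t : ℕ}
    (h : F.Runs (get v) U w U' t) (hU : ∀ k, T (ι k) = U k) (hU' : ∀ k, T' (ι k) = U' k)
    (hT : ∀ k, k ∉ Set.range ι → T' k = T k) :
    (F.lift ι get put).Runs v T (put w v) T' t := by
  obtain ⟨n, hn, h⟩ := h
  obtain ⟨T₁, h₁, h₂, h₃⟩ := h.lift hι hgp hpg hpp v T rfl (funext hU)
  have : T₁ = T' := by
    funext k
    by_cases hk : k ∈ Set.range ι
    · obtain ⟨k, rfl⟩ := hk
      exact (congrFun h₂ k).trans (hU' k).symm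
    · rw [h₃ k hk, hT k hk]
  subst this
  exact ⟨n, hn, h₁⟩

theorem single_apply_of_injective {ι : K' → K} (hι : Function.Injective ι) (k : K')
    (l : List (Γ (ι k))) (j : K') :
    single (ι k) l (ι j) = single (Γ := fun k => Γ (ι k)) k l j :=
  congrFun (Function.update_comp_eq_of_injective' _ hι _ _) j

theorem Runs.lift_single {ι : K' → K} {get : S → S'} {put : S' → S → S}
    {F : Frag (fun k => Γ (ι k)) S'} (hι : Function.Injective ι)
    (hgp : ∀ v s, get (put v s) = v) (hpg : ∀ s, put (get s) s = s)
    (hpp : ∀ v w s, put v (put w s) = put v s) {v : S} {w : S'} {k₀ k₁ : K'}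
    {l : List (Γ (ι k₀))} {l' : List (Γ (ι k₁))} {t : ℕ}
    (h : F.Runs (get v) (single k₀ l) w (single k₁ l') t) :
    (F.lift ι get put).Runs v (single (ι k₀) l) (put w v) (single (ι k₁) l') t := by
  refine h.lift hι hgp hpg hpp (single_apply_of_injective hι _ _)
    (single_apply_of_injective hι _ _) fun k hk => ?_
  have hk' : ∀ j, k ≠ ι j := fun j h => hk ⟨j, h.symm⟩
  simp [single, hk']

end

end Frag

/-! ### Fragments and polynomial-time computability -/

section PolyTime

variable {α β A B : Type} {ea : α → List A} {eb : β → List B} {f : α → β}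

theorem initList_stk (tm : FinTM2) (s : List (tm.Γ tm.k₀)) :
    initList tm s = ⟨some tm.main, tm.initialState, single tm.k₀ s⟩ := by
  unfold initList
  congr 1
  funext k
  by_cases h : k = tm.k₀
  · subst h; simp [single]
  · simp [single, h]

theorem haltList_stk (tm : FinTM2) (s : List (tm.Γ tm.k₁)) :
    haltList tm s = ⟨none, tm.initialState, single tm.k₁ s⟩ := by
  unfold haltList
  congr 1
  funext k
  by_cases h : k = tm.k₁
  · subst h; simp [single]
  · simp [single, h]

/-- The state must return to `v` because a halting configuration of the machine model carries the
initial state and has every stack but the output empty. -/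
theorem PolyTime.of_frag {K : Type} [DecidableEq K] [Fintype K] {Γ : K → Type} {S : Type}
    [Fintype S] (F : Frag Γ S) (k₀ k₁ : K) [Fintype (Γ k₀)] (e₀ : Γ k₀ ≃ A) (e₁ : Γ k₁ ≃ B) (v : S)
    (p : Polynomial ℕ) {l₀ : α → List (Γ k₀)} {l₁ : α → List (Γ k₁)}
    (h₀ : ∀ a, (ea a).map e₀.symm = l₀ a) (h₁ : ∀ a, (eb (f a)).map e₁.symm = l₁ a)
    (h : ∀ a, F.Runs v (single k₀ (l₀ a)) v (single k₁ (l₁ a)) (p.eval (ea a).length)) :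
    PolyTime ea eb f := by
  obtain rfl := funext h₀
  obtain rfl := funext h₁
  have := F.fin
  let tm : FinTM2 := ⟨k₀, k₁, Γ, F.Λ, F.main, S, v, F.code⟩
  refine ⟨⟨⟨tm, e₀, e₁⟩, p, fun a => ?_⟩⟩
  choose n hn hs using h a
  refine ⟨⟨n, ?_⟩, hn⟩
  rw [initList_stk]
  simp only [Option.map_some, haltList_stk]
  exact (steps_iff_iterate _ _ _ _).1 hs

/-- What a polynomial-time computable function provides. -/
theorem PolyTime.exists_frag (h : PolyTime ea eb f) :
    ∃ (K : Type) (_ : DecidableEq K) (_ : Fintype K) (Γ : K → Type) (S : Type) (_ : Fintype S)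
      (F : Frag Γ S) (k₀ k₁ : K) (_ : Fintype (Γ k₀)) (e₀ : Γ k₀ ≃ A) (e₁ : Γ k₁ ≃ B) (v : S)
      (p q : Polynomial ℕ), ∀ a,
        F.Runs v (single k₀ ((ea a).map e₀.symm)) v (single k₁ ((eb (f a)).map e₁.symm))
          (p.eval (ea a).length) ∧ (eb (f a)).length ≤ q.eval (ea a).length := by
  obtain ⟨⟨⟨tm, e₀, e₁⟩, p, h⟩⟩ := h
  have := tm.ΛFin
  let F : Frag tm.Γ tm.σ := ⟨tm.Λ, tm.ΛFin, tm.main, tm.m⟩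
  -- There are finitely many labels, so one constant bounds the pushes per step; input length plus
  -- `C` times the running time then bounds the output length.
  obtain ⟨C, hC⟩ : ∃ C, ∀ l, pushes (tm.m l) ≤ C :=
    ⟨Finset.univ.sup fun l => pushes (tm.m l),
      fun l => Finset.le_sup (f := fun l => pushes (tm.m l)) (Finset.mem_univ l)⟩
  refine ⟨tm.K, tm.kDecidableEq, tm.kFin, tm.Γ, tm.σ, tm.σFin, F, tm.k₀, tm.k₁, tm.Γk₀Fin, e₀, e₁,
    tm.initialState, p, .X + p * .C C, fun a => ?_⟩
  obtain ⟨⟨n, hs⟩, hn⟩ := h a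
  rw [initList_stk] at hs
  simp only [Option.map_some, haltList_stk] at hs
  have hs' := (steps_iff_iterate _ _ _ _).2 hs
  refine ⟨⟨n, hn, hs'⟩, ?_⟩
  have h₁ := hs'.length_le hC tm.k₁
  have h₂ : (single (Γ := tm.Γ) tm.k₀ ((ea a).map e₀.invFun) tm.k₁).length ≤ (ea a).length := by
    by_cases h : tm.k₁ = tm.k₀
    · unfold single
      -- The output stack may be the input stack. Both are fields of `tm`, so one is generalized
      -- before the equality can be substituted.
      generalize hk : tm.k₁ = k at h
      subst h
      simp
    · simp [single, h]
  simp only [single, Function.update_self, List.length_map] at h₁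
  simp only [Polynomial.eval_add, Polynomial.eval_X, Polynomial.eval_mul, Polynomial.eval_C]
  have h₃ : n * C ≤ p.eval (ea a).length * C := Nat.mul_le_mul_right _ hn
  exact h₁.trans (Nat.add_le_add h₂ h₃)

end PolyTime

/-! ### Moving stack contents -/

section Moves

variable {K : Type} [DecidableEq K] {Γ : K → Type} {Λ S : Type}

/-- Push a symbol if there is one. -/
noncomputable def pushOpt (j : K) (emit : S → Option (Γ j)) (q : Stmt Γ Λ S) : Stmt Γ Λ S :=
  open Classical in
  if h : Nonempty (Γ j) then
    .branch (fun v => (emit v).isSome) (.push j (fun v => (emit v).getD h.some) q) q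
  else q

theorem stepAux_pushOpt_some {j : K} {emit : S → Option (Γ j)} {q : Stmt Γ Λ S} {v : S}
    {T : ∀ k, List (Γ k)} {y : Γ j} (h : emit v = some y) :
    stepAux (pushOpt j emit q) v T = stepAux q v (Function.update T j (y :: T j)) := by
  have : Nonempty (Γ j) := ⟨y⟩
  simp [pushOpt, this, h]

theorem stepAux_pushOpt_none {j : K} {emit : S → Option (Γ j)} {q : Stmt Γ Λ S} {v : S}
    {T : ∀ k, List (Γ k)} (h : emit v = none) :
    stepAux (pushOpt j emit q) v T = stepAux q v T := by
  by_cases h' : Nonempty (Γ j) <;> simp [pushOpt, h', h]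

/-- Push the first `n` symbols of a list. -/
noncomputable def pushList (j : K) (emit : S → List (Γ j)) (q : Stmt Γ Λ S) : ℕ → Stmt Γ Λ S
  | 0 => q
  | n + 1 => pushOpt j (fun v => (emit v).head?) (pushList j (fun v => (emit v).tail) q n)

theorem stepAux_pushList {j : K} {emit : S → List (Γ j)} {q : Stmt Γ Λ S} {v : S}
    {T : ∀ k, List (Γ k)} {n : ℕ} (h : (emit v).length ≤ n) :
    stepAux (pushList j emit q n) v T =
      stepAux q v (Function.update T j ((emit v).reverse ++ T j)) := by
  induction n generalizing emit T with
  | zero => simp [pushList, List.length_eq_zero_iff.1 (Nat.le_zero.1 h)]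
  | succ n ih =>
    cases he : emit v with
    | nil =>
      rw [pushList, stepAux_pushOpt_none (by simp [he]), ih (by simp [he])]
      simp [he]
    | cons y l =>
      rw [pushList, stepAux_pushOpt_some (y := y) (by simp [he]), ih (by simp [he] at h ⊢; exact h)]
      simp [he]

/-- Move the contents of stack `i` to stack `j`. -/
noncomputable def move (i j : K) (set : S → Option (Γ i) → S) (emit : S → Option (Γ j)) :
    Frag Γ S :=
  .rep (.pop i set (pushOpt j emit (.branch (fun v => (emit v).isSome) (.goto fun _ => ()) .halt)))

/-- The popped symbol is kept in a register of the state, and popping the empty stack stores `none`,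
which ends the loop and clears the register. The order of the symbols is reversed. -/
theorem runs_move {i j : K} (hij : i ≠ j) {set : S → Option (Γ i) → S} {emit : S → Option (Γ j)}
    {f : Γ i → Γ j} (hset : ∀ v o o', set (set v o) o' = set v o')
    (hemit : ∀ v o, emit (set v o) = o.map f) {v : S} (hv : set v none = v)
    (T : ∀ k, List (Γ k)) :
    (move i j set emit).Runs v T v
      (Function.update (Function.update T i []) j ((T i).reverse.map f ++ T j))
      ((T i).length + 1) := by
  -- After the first pass the register holds the last symbol moved, so the induction needs an
  -- arbitrary register content `o`.
  suffices ∀ l (T : ∀ k, List (Γ k)) o, T i = l → (move i j set emit).Runs (set v o) T v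
      (Function.update (Function.update T i []) j (l.reverse.map f ++ T j)) (l.length + 1) by
    have := this _ T none rfl
    rwa [hv] at this
  intro l
  induction l with
  | nil =>
    intro T o hT
    refine Frag.runs_rep_halt ?_
    simp only [stepAux, hset, hT, List.head?_nil, List.tail_nil]
    rw [stepAux_pushOpt_none (by simp [hemit])]
    have he : emit v = none := by rw [← hv, hemit]; rfl
    rw [hv]
    simp [he, hij.symm]
  | cons x l ih =>
    intro T o hT
    refine Frag.runs_rep_goto (v₁ := set v (some x)) (T₁ := Function.update (Function.update T i l) j
      (f x :: (Function.update T i l) j)) ?_ ?_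
    · simp only [stepAux, hset, hT, List.head?_cons, List.tail_cons]
      rw [stepAux_pushOpt_some (y := f x) (by simp [hemit])]
      simp [hemit]
    · refine (ih _ (some x) (by simp [hij])).congr (fun k => ?_) (by simp)
      by_cases h : k = j
      · subst h; simp [hij.symm]
      · by_cases hi : k = i
        · subst hi; simp [h]
        · simp [h, hi]

theorem runs_move_single {i j : K} (hij : i ≠ j) {set : S → Option (Γ i) → S}
    {emit : S → Option (Γ j)} {f : Γ i → Γ j} (hset : ∀ v o o', set (set v o) o' = set v o')
    (hemit : ∀ v o, emit (set v o) = o.map f) {v : S} (hv : set v none = v) {l : List (Γ i)}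
    {l' : List (Γ j)} (hl : l.reverse.map f = l') {n : ℕ} (hn : l.length = n) :
    (move i j set emit).Runs v (single i l) v (single j l') (n + 1) := by
  refine (runs_move hij hset hemit hv (single i l)).congr (fun k => ?_) (by simp [single, hn])
  by_cases h : k = j
  · subst h; simp [single, hij.symm, hl]
  · by_cases h' : k = i
    · subst h'; simp [single, h]
    · simp [single, h, h']

/-- Move the contents of stack `i` to both stack `j` and stack `j'`. -/
noncomputable def moveTwo (i j j' : K) (set : S → Option (Γ i) → S) (emit : S → Option (Γ j))
    (emit' : S → Option (Γ j')) : Frag Γ S :=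
  .rep (.pop i set (pushOpt j emit (pushOpt j' emit'
    (.branch (fun v => (emit v).isSome) (.goto fun _ => ()) .halt))))

theorem runs_moveTwo {i j j' : K} (hij : i ≠ j) (hij' : i ≠ j') (hjj' : j ≠ j')
    {set : S → Option (Γ i) → S} {emit : S → Option (Γ j)} {emit' : S → Option (Γ j')}
    {f : Γ i → Γ j} {f' : Γ i → Γ j'} (hset : ∀ v o o', set (set v o) o' = set v o')
    (hemit : ∀ v o, emit (set v o) = o.map f) (hemit' : ∀ v o, emit' (set v o) = o.map f')
    {v : S} (hv : set v none = v) (T : ∀ k, List (Γ k)) :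
    (moveTwo i j j' set emit emit').Runs v T v
      (Function.update (Function.update (Function.update T i []) j ((T i).reverse.map f ++ T j))
        j' ((T i).reverse.map f' ++ T j')) ((T i).length + 1) := by
  suffices ∀ l (T : ∀ k, List (Γ k)) o, T i = l →
      (moveTwo i j j' set emit emit').Runs (set v o) T v
      (Function.update (Function.update (Function.update T i []) j (l.reverse.map f ++ T j))
        j' (l.reverse.map f' ++ T j')) (l.length + 1) by
    have := this _ T none rfl
    rwa [hv] at this
  intro l
  induction l with
  | nil =>
    intro T o hT
    refine Frag.runs_rep_halt ?_
    simp only [stepAux, hset, hT, List.head?_nil, List.tail_nil]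
    rw [stepAux_pushOpt_none (by simp [hemit]), stepAux_pushOpt_none (by simp [hemit'])]
    have he : emit v = none := by rw [← hv, hemit]; rfl
    rw [hv]
    simp only [stepAux, he, Option.isSome_none, cond_false, List.reverse_nil, List.map_nil,
      List.nil_append]
    congr 1
    funext k
    by_cases h' : k = j'
    · subst h'; simp [hij'.symm]
    by_cases h : k = j
    · subst h; simp [hij.symm, hjj']
    · simp [h, h']
  | cons x l ih =>
    intro T o hT
    refine Frag.runs_rep_goto (v₁ := set v (some x)) (T₁ := Function.update (Function.update (Function.update T i l) j
      (f x :: (Function.update T i l) j)) j' (f' x :: (Function.update (Function.update T i l) j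
      (f x :: (Function.update T i l) j)) j')) ?_ ?_
    · simp only [stepAux, hset, hT, List.head?_cons, List.tail_cons]
      rw [stepAux_pushOpt_some (y := f x) (by simp [hemit]),
        stepAux_pushOpt_some (y := f' x) (by simp [hemit'])]
      simp [hemit]
    · refine (ih _ (some x) (by simp [hij, hij'])).congr (fun k => ?_) (by simp)
      by_cases h' : k = j'
      · subst h'; simp [hij'.symm, hjj'.symm]
      by_cases h : k = j
      · subst h; simp [hij.symm, hjj']
      by_cases hi : k = i
      · subst hi; simp [h, h']
      · simp [h, h', hi]

end Moves

theorem eval_le_eval (p : Polynomial ℕ) {m n : ℕ} (h : m ≤ n) : p.eval m ≤ p.eval n := by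
  rw [Polynomial.eval_eq_sum, Polynomial.eval_eq_sum]
  exact Finset.sum_le_sum fun i _ => Nat.mul_le_mul_left _ (Nat.pow_le_pow_left h i)

/-! ### Closure properties of the polynomial-time computable functions -/

/-- The machines use disjoint stacks. The intermediate result goes through an extra stack, since a
single move would reverse it; its length bound `qf` enters the times of both moves and of the second
machine. -/
theorem PolyTime.comp {α β γ A B C : Type} {ea : α → List A} {eb : β → List B} {ec : γ → List C}
    {f : α → β} {g : β → γ} (hg : PolyTime eb ec g) (hf : PolyTime ea eb f) :
    PolyTime ea ec fun a => g (f a) := by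
  obtain ⟨K₁, _, _, Γ₁, S₁, _, F, k₀, k₁, _, e₀, e₁, v, pf, qf, hF⟩ := hf.exists_frag
  obtain ⟨K₂, _, _, Γ₂, S₂, _, G, j₀, j₁, _, d₀, d₁, w, pg, _, hG⟩ := hg.exists_frag
  have : Fintype B := Fintype.ofEquiv _ d₀
  let Γ : K₁ ⊕ (K₂ ⊕ Unit) → Type := Sum.elim Γ₁ (Sum.elim Γ₂ fun _ => B)
  let S := S₁ × S₂ × Option B
  have : Fintype (Γ (.inl k₀)) := ‹Fintype (Γ₁ k₀)›
  let F' : Frag Γ S := Frag.lift (Γ := Γ) .inl Prod.fst (fun x s => (x, s.2)) F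
  let G' : Frag Γ S := Frag.lift (Γ := Γ) (fun k => .inr (.inl k)) (fun s => s.2.1)
    (fun x s => (s.1, x, s.2.2)) G
  let M₁ : Frag Γ S := move (.inl k₁) (.inr (.inr ()))
    (fun s (o : Option (Γ₁ k₁)) => (s.1, s.2.1, o.map e₁)) fun s => s.2.2
  let M₂ : Frag Γ S := move (.inr (.inr ())) (.inr (.inl j₀))
    (fun s o => (s.1, s.2.1, o)) fun s => s.2.2.map d₀.symm
  refine PolyTime.of_frag (F'.seq (M₁.seq (M₂.seq G'))) (.inl k₀) (.inr (.inl j₁)) e₀ d₁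
    ((v, w, none) : S) (pf + ((qf + 1) + ((qf + 1) + pg.comp qf))) (fun _ => rfl) (fun _ => rfl)
    fun a => ?_
  obtain ⟨hf, hl⟩ := hF a
  obtain ⟨hg, -⟩ := hG (f a)
  have h₁ : ((eb (f a)).map e₁.symm).reverse.map e₁ = (eb (f a)).reverse := by
    simp [← List.map_reverse, Function.comp_def]
  have h₂ : (eb (f a)).reverse.reverse.map d₀.symm = (eb (f a)).map d₀.symm := by simp
  have r₁ : F'.Runs (v, w, none) (single (Γ := Γ) (.inl k₀) ((ea a).map e₀.symm))
      (v, w, none) (single (Γ := Γ) (.inl k₁) ((eb (f a)).map e₁.symm)) _ :=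
    Frag.Runs.lift_single (Γ := Γ) (get := Prod.fst) (put := fun x s => (x, s.2))
      (v := ((v, w, none) : S)) Sum.inl_injective (fun _ _ => rfl) (fun _ => rfl)
      (fun _ _ _ => rfl) hf
  have r₂ := runs_move_single (Γ := Γ) (i := .inl k₁) (j := .inr (.inr ()))
    (set := fun (s : S) (o : Option (Γ₁ k₁)) => ((s.1, s.2.1, o.map e₁) : S))
    (emit := fun s => s.2.2) (f := e₁) (by simp) (fun _ _ _ => rfl) (fun _ _ => rfl)
    (v := (v, w, none)) rfl h₁
    (n := (eb (f a)).length) (List.length_map _)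
  have r₃ := runs_move_single (Γ := Γ) (i := .inr (.inr ())) (j := .inr (.inl j₀))
    (set := fun (s : S) o => ((s.1, s.2.1, o) : S))
    (emit := fun s => s.2.2.map d₀.symm) (f := d₀.symm) (by simp) (fun _ _ _ => rfl)
    (fun _ _ => rfl) (v := (v, w, none)) rfl h₂
    (n := (eb (f a)).length) List.length_reverse
  have r₄ : G'.Runs (v, w, none) (single (Γ := Γ) (.inr (.inl j₀)) ((eb (f a)).map d₀.symm))
      (v, w, none) (single (Γ := Γ) (.inr (.inl j₁)) ((ec (g (f a))).map d₁.symm)) _ :=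
    Frag.Runs.lift_single (Γ := Γ) (ι := fun k => .inr (.inl k)) (get := fun s => s.2.1)
      (put := fun x s => (s.1, x, s.2.2)) (v := ((v, w, none) : S)) (fun _ _ h => by simpa using h)
      (fun _ _ => rfl) (fun _ => rfl) (fun _ _ _ => rfl) hg
  refine (r₁.seq (r₂.seq (r₃.seq r₄))).mono ?_
  have := eval_le_eval pg hl
  simp only [Polynomial.eval_add, Polynomial.eval_comp, Polynomial.eval_one]
  omega

/-- Names of stacks: an input stack, an output stack and auxiliary ones. -/
inductive Reg
  | src
  | dst
  | aux₁
  | aux₂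
  | aux₃
  deriving DecidableEq

instance : Fintype Reg := ⟨{.src, .dst, .aux₁, .aux₂, .aux₃}, fun k => by cases k <;> simp⟩

/-! ### Finite-state transducers -/

section Transducer

variable {Q A B : Type}

/-- The output of a finite-state transducer with transition function `δ`, that emits `em`
at each transition and `last` at the end of the input. -/
def transduce (δ : Q → A → Q) (em : Q → A → List B) (last : Q → List B) : Q → List A → List B
  | q, [] => last q
  | q, a :: l => em q a ++ transduce δ em last (δ q a) l

/-- The alphabets of the stacks of a transducer. -/
abbrev transduceΓ (A B : Type) : Reg → Type
  | .src => A
  | _ => B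

theorem length_transduce_le (δ : Q → A → Q) {em : Q → A → List B} {last : Q → List B} {N : ℕ}
    (hem : ∀ q a, (em q a).length ≤ N) (hlast : ∀ q, (last q).length ≤ N) (q : Q) (l : List A) :
    (transduce δ em last q l).length ≤ N * (l.length + 1) := by
  induction l generalizing q with
  | nil => simpa [transduce] using hlast q
  | cons a l ih =>
    have := hem q a
    have := ih (δ q a)
    simp only [transduce, List.length_append, List.length_cons]
    linarith

section

variable {K : Type} [DecidableEq K] {Γ : K → Type} {R : Type} (i j : K)
  (δ : Q → Γ i → Q) (em : Q → Γ i → List (Γ j)) (last : Q → List (Γ j))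

/-- The symbols emitted by a transducer in a state that includes the symbol just read. -/
def emitted (s : Q × Option (Γ i) × R) : List (Γ j) := s.2.1.elim (last s.1) (em s.1)

/-- Run a transducer on stack `i`, with the output pushed to stack `j`. -/
noncomputable def transducer (q₀ : Q) (N : ℕ) : Frag Γ (Q × Option (Γ i) × R) :=
  .rep (.pop i (fun s o => (s.1, o, s.2.2)) (pushList j (emitted i j em last)
    (.branch (fun s => s.2.1.isSome)
      (.load (fun s => (s.2.1.elim s.1 (δ s.1), s.2)) (.goto fun _ => ()))
      (.load (fun s => (q₀, s.2)) .halt)) N))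

theorem runs_transducer {i j : K} (hij : i ≠ j) {δ : Q → Γ i → Q} {em : Q → Γ i → List (Γ j)}
    {last : Q → List (Γ j)} (q₀ : Q) {N : ℕ} (hem : ∀ q a, (em q a).length ≤ N)
    (hlast : ∀ q, (last q).length ≤ N) {l : List (Γ i)} (T : ∀ k, List (Γ k)) (hT : T i = l)
    (q : Q) (o : Option (Γ i)) (r : R) :
    (transducer i j δ em last q₀ N).Runs (q, o, r) T (q₀, none, r) (Function.update
      (Function.update T i []) j ((transduce δ em last q l).reverse ++ T j)) (l.length + 1) := by
  have hout : ∀ s : Q × Option (Γ i) × R, (emitted i j em last s).length ≤ N := by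
    rintro ⟨q, _ | a, o⟩
    · exact hlast q
    · exact hem q a
  induction l generalizing T q o with
  | nil =>
    refine Frag.runs_rep_halt ?_
    simp only [stepAux, hT, List.head?_nil, List.tail_nil]
    rw [stepAux_pushList (hout _)]
    simp [emitted, transduce, hij.symm]
  | cons a l ih =>
    refine Frag.runs_rep_goto (v₁ := (δ q a, some a, r)) (T₁ := Function.update
      (Function.update T i l) j ((em q a).reverse ++ T j)) ?_ ?_
    · simp only [stepAux, hT, List.head?_cons, List.tail_cons]
      rw [stepAux_pushList (hout _)]
      simp [emitted, hij.symm]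
    · refine (ih _ (by simp [hij]) _ _).congr (fun k => ?_) (by simp)
      by_cases h : k = j
      · subst h; simp [transduce]
      · by_cases hi : k = i
        · subst hi; simp [h]
        · simp [h, hi]

theorem runs_transducer_single {i j : K} (hij : i ≠ j) {δ : Q → Γ i → Q}
    {em : Q → Γ i → List (Γ j)} {last : Q → List (Γ j)} (q₀ : Q) {N : ℕ}
    (hem : ∀ q a, (em q a).length ≤ N) (hlast : ∀ q, (last q).length ≤ N) (l : List (Γ i))
    {l' : List (Γ j)} (hl' : (transduce δ em last q₀ l).reverse = l') (r : R) :
    (transducer i j δ em last q₀ N).Runs (q₀, none, r) (single i l) (q₀, none, r) (single j l')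
      (l.length + 1) := by
  refine (runs_transducer hij q₀ hem hlast (single i l) (l := l) (by simp [single]) q₀ none
    r).congr (fun k => ?_) le_rfl
  by_cases h : k = j
  · subst h; simp [single, hij.symm, hl']
  · by_cases hi : k = i
    · subst hi; simp [single, h]
    · simp [single, h, hi]

end

/-- One pass leaves the output reversed on an auxiliary stack, and one move restores its order.
Finiteness of `Q` and `A` gives a uniform bound `N` on what is emitted per symbol. -/
theorem PolyTime.of_transduce [Fintype Q] [Fintype A] [Fintype B] {α β : Type} {ea : α → List A}
    {eb : β → List B} {f : α → β} (δ : Q → A → Q) (em : Q → A → List B) (last : Q → List B)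
    (q₀ : Q) (h : ∀ a, eb (f a) = transduce δ em last q₀ (ea a)) : PolyTime ea eb f := by
  obtain ⟨N, hem, hlast⟩ :
      ∃ N, (∀ q a, (em q a).length ≤ N) ∧ ∀ q, (last q).length ≤ N := by
    obtain ⟨N₁, h₁⟩ := Finite.exists_le fun x : Q × A => (em x.1 x.2).length
    obtain ⟨N₂, h₂⟩ := Finite.exists_le fun q => (last q).length
    exact ⟨max N₁ N₂, fun q a => (h₁ (q, a)).trans (le_max_left _ _),
      fun q => (h₂ q).trans (le_max_right _ _)⟩
  let S := Q × Option A × Option B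
  have : Fintype (transduceΓ A B .src) := ‹Fintype A›
  let F : Frag (transduceΓ A B) S := transducer Reg.src Reg.aux₁ δ em last q₀ N
  let M : Frag (transduceΓ A B) S := move .aux₁ .dst (fun s o => (s.1, s.2.1, o)) fun s => s.2.2
  refine PolyTime.of_frag (F.seq M) .src .dst (Equiv.refl A) (Equiv.refl B)
    ((q₀, none, none) : S) (.X + 1 + (.C N * (.X + 1) + 1))
    (fun a => List.map_id (ea a)) (fun a => List.map_id (eb (f a))) fun a => ?_
  have hl : (eb (f a)).reverse.length ≤ N * ((ea a).length + 1) := by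
    rw [List.length_reverse, h]
    exact length_transduce_le δ hem hlast q₀ _
  have r₁ : F.Runs (q₀, none, none) (single (Γ := transduceΓ A B) .src (ea a))
      (q₀, none, none) (single (Γ := transduceΓ A B) .aux₁ (eb (f a)).reverse)
      ((ea a).length + 1) :=
    runs_transducer_single (Γ := transduceΓ A B) (i := .src) (j := .aux₁) (δ := δ) (em := em)
      (last := last) (by simp) q₀ hem hlast (ea a)
      (by rw [h]) none
  have r₂ := runs_move_single (Γ := transduceΓ A B) (i := .aux₁) (j := .dst) (by simp)
    (set := fun (s : S) o => ((s.1, s.2.1, o) : S)) (emit := fun s => s.2.2)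
    (f := id) (fun _ _ _ => rfl) (fun _ _ => Option.map_id'.symm) (v := (q₀, none, none)) rfl
    (l := (eb (f a)).reverse) (l' := eb (f a)) (by simp) rfl
  refine (r₁.seq r₂).mono ?_
  simp only [Polynomial.eval_add, Polynomial.eval_mul, Polynomial.eval_X, Polynomial.eval_C,
    Polynomial.eval_one]
  exact Nat.add_le_add_left (Nat.add_le_add_right hl 1) _

end Transducer

/-- Additional stacks with symbols `0`, `1` and the delimiter. -/
abbrev extendΓ {K : Type} (Γ : K → Type) : K ⊕ Reg → Type
  | .inl k => Γ k
  | .inr _ => Option Bool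

theorem polyTime_map_some : PolyTime (id : Str → Str) (List.map some) (fun a : Str => a) :=
  .of_transduce (Q := Unit) (fun _ _ => ()) (fun _ b => [some b]) (fun _ => []) () fun a => by
    induction a with
    | nil => rfl
    | cons b a ih => exact congrArg (_ :: ·) ih

theorem polyTime_of_map_some : PolyTime (List.map some) (id : Str → Str) (fun a : Str => a) :=
  .of_transduce (Q := Unit) (fun _ _ => ()) (fun _ b => b.toList) (fun _ => []) () fun a => by
    induction a with
    | nil => rfl
    | cons b a ih => exact congrArg (_ :: ·) ih

/-- The stack contents in the computation of `a ↦ (a, h a)`. -/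
def pairStk {K : Type} {Γ : K → Type} (U : ∀ k, List (Γ k)) (r s o : List (Option Bool)) :
    ∀ k, List (extendΓ Γ k)
  | .inl k => U k
  | .inr .aux₁ => r
  | .inr .aux₂ => s
  | .inr .dst => o
  | .inr .src => []
  | .inr .aux₃ => []

/-- The input is duplicated; one copy is fed to the machine for `h` and the other waits. The output
is built from its right end: `h a`, the delimiter, then `a`. Passing to the alphabet with a
delimiter lets all added stacks share one alphabet. -/
theorem PolyTime.pair {h : Str → Str} (hh : PolyTime id id h) :
    PolyTime id encodePair fun a => (a, h a) := by
  have hh' : PolyTime (List.map some) (List.map some) h :=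
    polyTime_map_some.comp (hh.comp polyTime_of_map_some)
  suffices PolyTime (List.map some) encodePair fun a => (a, h a) from this.comp polyTime_map_some
  obtain ⟨K, _, _, Γ₁, S₁, _, H, k₀, k₁, _, e₀, e₁, v, p, q, hH⟩ := hh'.exists_frag
  let S := S₁ × Option (Option Bool)
  let F₁ : Frag (extendΓ Γ₁) S := moveTwo (.inr .src) (.inr .aux₁) (.inr .aux₂)
    (fun s o => (s.1, o)) (fun s => s.2) fun s => s.2
  let F₂ : Frag (extendΓ Γ₁) S := move (.inr .aux₁) (.inl k₀) (fun s o => (s.1, o))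
    fun s => s.2.map e₀.symm
  let F₃ : Frag (extendΓ Γ₁) S := Frag.lift (Γ := extendΓ Γ₁) .inl Prod.fst (fun x s => (x, s.2)) H
  let F₄ : Frag (extendΓ Γ₁) S := move (.inl k₁) (.inr .aux₁)
    (fun s (o : Option (Γ₁ k₁)) => (s.1, o.map e₁)) fun s => s.2
  let F₅ : Frag (extendΓ Γ₁) S := move (.inr .aux₁) (.inr .dst) (fun s o => (s.1, o)) fun s => s.2
  let F₆ : Frag (extendΓ Γ₁) S := .rep (.push (.inr .dst) (fun _ => none) .halt)
  let F₇ : Frag (extendΓ Γ₁) S := move (.inr .aux₂) (.inr .dst) (fun s o => (s.1, o)) fun s => s.2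
  refine PolyTime.of_frag (F₁.seq (F₂.seq (F₃.seq (F₄.seq (F₅.seq (F₆.seq F₇))))))
    (.inr .src) (.inr .dst) (Equiv.refl (Option Bool)) (Equiv.refl (Option Bool)) ((v, none) : S)
    (.X + 1 + (.X + 1 + (p + (q + 1 + (q + 1 + (1 + (.X + 1)))))))
    (fun a => List.map_id _) (fun a => List.map_id _) fun a => ?_
  obtain ⟨r₃, hl⟩ := hH a
  generalize ha : a.map some = a' at *
  generalize hb : (h a).map some = b' at *
  rw [show encodePair (a, h a) = a' ++ none :: b' by rw [← ha, ← hb]; rfl]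
  let E : ∀ k, List (Γ₁ k) := fun _ => []
  have s₁ : F₁.Runs (v, none) (single (Γ := extendΓ Γ₁) (.inr .src) a') (v, none)
      (pairStk E a'.reverse a'.reverse []) (a'.length + 1) := by
    refine Frag.Runs.congr (runs_moveTwo (i := Sum.inr Reg.src) (j := Sum.inr Reg.aux₁) (j' := Sum.inr Reg.aux₂) (by simp) (by simp) (by simp) (f := id) (f' := id) ?_
      ?_ ?_ ?_ _) ?_ ?_
    · exact fun _ _ _ => rfl
    · exact fun _ _ => Option.map_id'.symm
    · exact fun _ _ => Option.map_id'.symm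
    · rfl
    · rintro (k | (_ | _)) <;> simp [single, pairStk, E]
    · simp [single]
  have s₂ : F₂.Runs (v, none) (pairStk E a'.reverse a'.reverse []) (v, none)
      (pairStk (single k₀ (a'.map e₀.symm)) [] a'.reverse []) (a'.length + 1) := by
    refine Frag.Runs.congr (runs_move (i := Sum.inr Reg.aux₁) (j := Sum.inl k₀) (by simp) (f := e₀.symm) ?_
      ?_ ?_ _) ?_ ?_
    · exact fun _ _ _ => rfl
    · exact fun _ _ => rfl
    · rfl
    · rintro (k | (_ | _))
      · by_cases h : k = k₀
        · subst h; simp [single, pairStk, E]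
        · simp [single, pairStk, E, h]
      all_goals simp [pairStk]
    · simp [pairStk]
  have s₃ : F₃.Runs (v, none) (pairStk (single k₀ (a'.map e₀.symm)) [] a'.reverse []) (v, none)
      (pairStk (single k₁ (b'.map e₁.symm)) [] a'.reverse []) (p.eval a'.length) :=
    Frag.Runs.lift (v := ((v, none) : S)) (Γ := extendΓ Γ₁) (get := Prod.fst)
      (put := fun x s => (x, s.2)) Sum.inl_injective (fun _ _ => rfl)
      (fun _ => rfl) (fun _ _ _ => rfl) r₃ (fun _ => rfl) (fun _ => rfl) (by
        rintro (k | (_ | _)) hk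
        · exact absurd ⟨k, rfl⟩ hk
        all_goals rfl)
  have s₄ : F₄.Runs (v, none) (pairStk (single k₁ (b'.map e₁.symm)) [] a'.reverse []) (v, none)
      (pairStk E b'.reverse a'.reverse []) (b'.length + 1) := by
    refine Frag.Runs.congr (runs_move (i := Sum.inl k₁) (j := Sum.inr Reg.aux₁) (by simp) (f := e₁) ?_
      ?_ ?_ _) ?_ ?_
    · exact fun _ _ _ => rfl
    · exact fun _ _ => rfl
    · rfl
    · rintro (k | (_ | _))
      · by_cases h : k = k₁
        · subst h; simp [single, pairStk, E]
        · simp [single, pairStk, E, h]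
      all_goals simp [pairStk, single, Function.comp_def, ← List.map_reverse]
    · simp [pairStk, single]
  have s₅ : F₅.Runs (v, none) (pairStk E b'.reverse a'.reverse []) (v, none)
      (pairStk E [] a'.reverse b') (b'.length + 1) := by
    refine Frag.Runs.congr (runs_move (i := Sum.inr Reg.aux₁) (j := Sum.inr Reg.dst) (by simp) (f := id) ?_
      ?_ ?_ _) ?_ ?_
    · exact fun _ _ _ => rfl
    · exact fun _ _ => Option.map_id'.symm
    · rfl
    · rintro (k | (_ | _)) <;> simp [pairStk, E]
    · simp [pairStk]
  have s₆ : F₆.Runs (v, none) (pairStk E [] a'.reverse b') (v, none)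
      (pairStk E [] a'.reverse (none :: b')) 1 := by
    refine (Frag.runs_rep_halt rfl).congr ?_ le_rfl
    rintro (k | (_ | _)) <;> simp [pairStk]
  have s₇ : F₇.Runs (v, none) (pairStk E [] a'.reverse (none :: b')) (v, none)
      (single (Γ := extendΓ Γ₁) (.inr .dst) (a' ++ none :: b')) (a'.length + 1) := by
    refine Frag.Runs.congr (runs_move (i := Sum.inr Reg.aux₂) (j := Sum.inr Reg.dst) (by simp) (f := id) ?_
      ?_ ?_ _) ?_ ?_
    · exact fun _ _ _ => rfl
    · exact fun _ _ => Option.map_id'.symm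
    · rfl
    · rintro (k | (_ | _)) <;> simp [single, pairStk, E]
    · simp [pairStk]
  refine (s₁.seq (s₂.seq (s₃.seq (s₄.seq (s₅.seq (s₆.seq s₇)))))).mono ?_
  simp only [Polynomial.eval_add, Polynomial.eval_X, Polynomial.eval_one] at hl ⊢
  omega

/-- Stacks with symbols `0`, `1` and the delimiter. -/
abbrev regΓ : Reg → Type := fun _ => Option Bool

/-- Contents of the stacks. -/
def regStk (s d a₁ a₂ a₃ : List (Option Bool)) : ∀ k, List (regΓ k)
  | .src => s
  | .dst => d
  | .aux₁ => a₁
  | .aux₂ => a₂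
  | .aux₃ => a₃

theorem single_src (l : List (Option Bool)) (k : Reg) :
    single (Γ := regΓ) .src l k = regStk l [] [] [] [] k := by
  cases k <;> simp [single, regStk]

theorem single_dst (l : List (Option Bool)) (k : Reg) :
    single (Γ := regΓ) .dst l k = regStk [] l [] [] [] k := by
  cases k <;> simp [single, regStk]

section Split

variable {S : Type} (get : S → Option (Option Bool)) (set : S → Option (Option Bool) → S)

/-- Move the symbols above the topmost delimiter from the input stack to the first auxiliary
stack, and remove the delimiter. -/
noncomputable def splitSrc : Frag regΓ S :=
  .rep (.pop .src set (pushOpt .aux₁ (fun v => (get v).bind (Option.map some))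
    (.branch (fun v => (get v).join.isSome) (.goto fun _ => ())
      (.load (fun v => set v none) .halt))))

/-- Popping the delimiter gives `some none` in the register, so `join` distinguishes it from a bit.
The first string ends up reversed. -/
theorem runs_splitSrc {get : S → Option (Option Bool)} {set : S → Option (Option Bool) → S}
    (hset : ∀ v o o', set (set v o) o' = set v o') (hget : ∀ v o, get (set v o) = o) {v : S}
    (hv : set v none = v) (a : Str) (r : List (Option Bool)) :
    (splitSrc get set).Runs v (regStk (a.map some ++ none :: r) [] [] [] []) v
      (regStk r [] (a.map some).reverse [] []) (a.length + 1) := by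
  suffices ∀ a₁ o, (splitSrc get set).Runs (set v o)
      (regStk (a.map some ++ none :: r) [] a₁ [] []) v
      (regStk r [] ((a.map some).reverse ++ a₁) [] []) (a.length + 1) by
    have := this [] none
    rwa [hv, List.append_nil] at this
  induction a with
  | nil =>
    intro a₁ o
    refine Frag.Runs.congr (Frag.runs_rep_halt (T' := regStk r [] a₁ [] []) ?_) (fun k => ?_) le_rfl
    · simp only [stepAux, hset]
      rw [stepAux_pushOpt_none (by simp [hget, regStk])]
      simp only [stepAux, hget, hset, hv, regStk, List.map_nil, List.nil_append, List.head?_cons,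
        Option.join_some, Option.isSome_none, cond_false, List.tail_cons]
      congr 1
      funext k
      cases k <;> simp [regStk]
    · simp
  | cons b a ih =>
    intro a₁ o
    refine Frag.runs_rep_goto (v₁ := set v (some (some b)))
      (T₁ := regStk (a.map some ++ none :: r) [] (some b :: a₁) [] []) ?_ ?_
    · simp only [stepAux, hset]
      rw [stepAux_pushOpt_some (y := some b) (by simp [hget, regStk])]
      simp only [stepAux, hget, regStk, List.map_cons, List.cons_append, List.head?_cons,
        Option.join_some, Option.isSome_some, cond_true, List.tail_cons]
      congr 1
      funext k
      cases k <;> simp [regStk]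
    · exact (ih (some b :: a₁) (some (some b))).congr (fun k => by simp) le_rfl

end Split

/-! ### Unary evaluation of polynomials -/

/-- This is one Horner step in unary. For each symbol of the second string, the first is moved away
and back, emitting one `false` per symbol on the way; finally `c` more are pushed, then the
delimiter and the first string. -/
theorem polyTime_horner (c : ℕ) : PolyTime encodePair encodePair
    fun y : Str × Str => (y.1, List.replicate (c + y.2.length * y.1.length) false) := by
  let S := Option (Option Bool)
  let setReg : S → Option (Option Bool) → S := fun _ o => o
  let F₁ : Frag regΓ S := splitSrc id setReg
  let F₂ : Frag regΓ S := move .src .aux₃ setReg id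
  let q : Stmt regΓ Unit S := .pop .aux₃ setReg (.branch Option.isSome
    (.load (fun _ => none) (.goto fun _ => ())) .halt)
  let F₃ : Frag regΓ S := moveTwo .aux₁ .aux₂ .dst setReg id (Option.map fun _ => some false)
  let F₄ : Frag regΓ S := move .aux₂ .aux₁ setReg id
  let F₅ : Frag regΓ S := .rep (pushList .dst
    (fun _ => List.replicate c (some false) ++ [none]) .halt (c + 1))
  let F₆ : Frag regΓ S := move .aux₁ .dst setReg id
  have hloop : ∀ (x u d : List (Option Bool)), (Frag.loop q (F₃.seq F₄)).Runs none
      (regStk [] d x [] u) none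
      (regStk [] (List.replicate (u.length * x.length) (some false) ++ d) x [] [])
      (u.length * (2 * (x.length + 1) + 1) + 1) := by
    intro x u
    induction u with
    | nil =>
      intro d
      refine Frag.Runs.congr (Frag.runs_loop_halt (T' := regStk [] d x [] []) ?_) (fun k => ?_)
        (by simp)
      · simp only [q, stepAux, regStk, setReg, List.head?_nil, Option.isSome_none, cond_false]
        congr 1
        funext k
        cases k <;> simp [regStk]
      · simp
    | cons y u ih =>
      intro d
      have s₃ : F₃.Runs none (regStk [] d x [] u) none
          (regStk [] (List.replicate x.length (some false) ++ d) [] x.reverse u)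
          (x.length + 1) := by
        refine Frag.Runs.congr (runs_moveTwo (i := Reg.aux₁) (j := Reg.aux₂) (j' := Reg.dst)
          (by simp) (by simp) (by simp) (f := id) (f' := fun _ => some false) ?_ ?_ ?_ ?_ _) ?_ ?_
        · exact fun _ _ _ => rfl
        · exact fun _ _ => Option.map_id'.symm
        · exact fun _ _ => rfl
        · rfl
        · rintro (_ | _) <;> simp [regStk]
        · simp [regStk]
      have s₄ : F₄.Runs none
          (regStk [] (List.replicate x.length (some false) ++ d) [] x.reverse u) none
          (regStk [] (List.replicate x.length (some false) ++ d) x [] u) (x.length + 1) := by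
        refine Frag.Runs.congr (runs_move (i := Reg.aux₂) (j := Reg.aux₁) (by simp) (f := id)
          ?_ ?_ ?_ _) ?_ ?_
        · exact fun _ _ _ => rfl
        · exact fun _ _ => Option.map_id'.symm
        · rfl
        · rintro (_ | _) <;> simp [regStk]
        · simp [regStk]
      refine Frag.Runs.congr (Frag.runs_loop_goto (v₁ := none) (T₁ := regStk [] d x [] u) ?_
        (s₃.seq s₄) (ih _)) (fun k => ?_) ?_
      · simp only [q, stepAux, regStk, setReg, List.head?_cons, Option.isSome_some, cond_true]
        congr 1
        funext k
        cases k <;> simp [regStk]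
      · congr 1
        rw [← List.append_assoc, List.replicate_append_replicate, List.length_cons]
        congr 2
        ring
      · simp only [List.length_cons]
        apply le_of_eq
        ring
  refine PolyTime.of_frag (F₁.seq (F₂.seq ((Frag.loop q (F₃.seq F₄)).seq (F₅.seq F₆))))
    .src .dst (Equiv.refl (Option Bool)) (Equiv.refl (Option Bool)) (none : S)
    (.X + 1 + (.X + 1 + (.X * (2 * (.X + 1) + 1) + 1 + (1 + (.X + 1)))))
    (fun a => List.map_id _) (fun a => List.map_id _) fun a => ?_
  obtain ⟨x, u⟩ := a
  have s₁ : F₁.Runs none (regStk (encodePair (x, u)) [] [] [] []) none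
      (regStk (u.map some) [] (x.map some).reverse [] []) (x.length + 1) := by
    refine runs_splitSrc ?_ ?_ ?_ _ _
    · exact fun _ _ _ => rfl
    · exact fun _ _ => rfl
    · rfl
  have s₂ : F₂.Runs none (regStk (u.map some) [] (x.map some).reverse [] []) none
      (regStk [] [] (x.map some).reverse [] (u.map some).reverse) (u.length + 1) := by
    refine Frag.Runs.congr (runs_move (i := Reg.src) (j := Reg.aux₃) (by simp) (f := id)
      ?_ ?_ ?_ _) ?_ ?_
    · exact fun _ _ _ => rfl
    · exact fun _ _ => Option.map_id'.symm
    · rfl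
    · rintro (_ | _) <;> simp [regStk]
    · simp [regStk]
  have s₃ := hloop (x.map some).reverse (u.map some).reverse []
  have s₅ : ∀ d, F₅.Runs none (regStk [] d (x.map some).reverse [] []) none
      (regStk [] (none :: (List.replicate c (some false) ++ d)) (x.map some).reverse [] [])
      1 := by
    intro d
    refine Frag.runs_rep_halt ?_
    rw [stepAux_pushList (by simp)]
    simp only [stepAux]
    congr 1
    funext k
    cases k <;> simp [regStk]
  have s₆ : ∀ d, F₆.Runs none (regStk [] d (x.map some).reverse [] []) none
      (regStk [] (x.map some ++ d) [] [] []) (x.length + 1) := by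
    intro d
    refine Frag.Runs.congr (runs_move (i := Reg.aux₁) (j := Reg.dst) (by simp) (f := id)
      ?_ ?_ ?_ _) ?_ ?_
    · exact fun _ _ _ => rfl
    · exact fun _ _ => Option.map_id'.symm
    · rfl
    · rintro (_ | _) <;> simp [regStk]
    · simp [regStk]
  rw [funext (single_src _)]
  refine (s₁.seq (s₂.seq (s₃.seq ((s₅ _).seq (s₆ _))))).congr (fun k => ?_) ?_
  · rw [single_dst]
    congr 1
    simp [encodePair, List.replicate_append_replicate]
  · have hx : x.length ≤ (encodePair (x, u)).length := by simp [encodePair]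
    have hu : u.length ≤ (encodePair (x, u)).length := by simp [encodePair]; omega
    generalize (encodePair (x, u)).length = n at hx hu
    have : u.length * (2 * (x.length + 1) + 1) ≤ n * (2 * (n + 1) + 1) :=
      Nat.mul_le_mul hu (by omega)
    simp only [Polynomial.eval_add, Polynomial.eval_mul, Polynomial.eval_X, Polynomial.eval_one,
      Polynomial.eval_ofNat, List.length_reverse, List.length_map]
    omega

/-- Appending the value of a polynomial at the length of the input, in unary. -/
theorem polyTime_pair_unary (p : Polynomial ℕ) : PolyTime id encodePair
    fun x : Str => (x, List.replicate (p.eval x.length) false) := by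
  induction hn : p.natDegree using Nat.strong_induction_on generalizing p with
  | _ n ih =>
    have key : PolyTime id encodePair
        fun x : Str => (x, List.replicate (p.divX.eval x.length) false) := by
      -- For a constant polynomial the degree of `divX` does not drop, but `divX` is zero and only a
      -- delimiter has to be appended.
      rcases Nat.eq_zero_or_pos n with h0 | h0
      · have hp : p.divX = 0 := by
          rw [Polynomial.divX_eq_zero_iff]
          exact Polynomial.eq_C_of_natDegree_eq_zero (hn.trans h0)
        refine .of_transduce (Q := Unit) (fun _ _ => ()) (fun _ b => [some b])
          (fun _ => [none]) () fun a => ?_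
        simp only [hp, Polynomial.eval_zero, List.replicate_zero, encodePair, id]
        induction a with
        | nil => rfl
        | cons b a ih => exact congrArg (_ :: ·) ih
      · exact ih _ (by rw [Polynomial.natDegree_divX_eq_natDegree_tsub_one]; omega) _ rfl
    have := (polyTime_horner (p.coeff 0)).comp key
    convert this using 4 with x
    -- Horner's rule: the value of `p` is the constant coefficient plus the value of `p.divX` times
    -- the length of `x`.
    conv_lhs => rw [← Polynomial.divX_mul_X_add p]
    simp [add_comm]

/-! ### Pairs of strings of the same length that hold an instance and a witness -/

/-- The phases of reading two strings in parallel. The flag says whether the roles of the two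
strings are exchanged. -/
inductive Phase
  | start
  | pad (f : Bool)
  | wit (f : Bool)
  | inp (f : Bool)
  | rej
  deriving DecidableEq

instance : Fintype Phase :=
  ⟨{.start, .pad true, .pad false, .wit true, .wit false, .inp true, .inp false, .rej}, fun φ => by
    rcases φ with _ | (_ | _) | (_ | _) | (_ | _) | _ <;> decide⟩

/-- The next phase and the symbol that is emitted. -/
def Phase.step : Phase → Option Bool → Option Bool → Phase × Option (Option Bool)
  | start, some s, some t => (if s = t then rej else pad s, none)
  | pad f, some s, some t =>
    (if bif f then t else s then rej else if bif f then s else t then wit f else pad f, none)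
  | wit f, some s, some t =>
    if bif f then t else s then (inp f, some none) else (wit f, some (some (bif f then s else t)))
  | inp f, some s, some t => (inp f, some (some (bif f then t else s)))
  | _, _, _ => (rej, none)

/-- Whether a complete instance and witness have been read. -/
def Phase.accepting : Phase → Bool
  | inp _ => true
  | _ => false

/-- A phase with the witness and the instance read so far. -/
inductive Conf
  | start
  | pad (f : Bool)
  | wit (f : Bool) (w : Str)
  | inp (f : Bool) (w x : Str)
  | rej (o : List (Option Bool))

namespace Conf

/-- The phase of a configuration. -/
def phase : Conf → Phase
  | start => .start
  | pad f => .pad f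
  | wit f _ => .wit f
  | inp f _ _ => .inp f
  | rej _ => .rej

/-- What has been emitted. -/
def out : Conf → List (Option Bool)
  | start => []
  | pad _ => []
  | wit _ w => w.map some
  | inp _ w x => encodePair (x, w)
  | rej o => o

/-- Read a symbol of each string. -/
def step : Conf → Option Bool → Option Bool → Conf
  | start, some s, some t => if s = t then rej [] else pad s
  | pad f, some s, some t =>
    if bif f then t else s then rej [] else if bif f then s else t then wit f [] else pad f
  | wit f w, some s, some t =>
    if bif f then t else s then inp f w [] else wit f ((bif f then s else t) :: w)
  | inp f w x, some s, some t => inp f w ((bif f then t else s) :: x)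
  | c, _, _ => rej c.out

theorem phase_step (c : Conf) (s t : Option Bool) : (c.step s t).phase = (c.phase.step s t).1 := by
  rcases c with _ | f | f | f | _ <;> rcases s with _ | s <;> rcases t with _ | t <;>
    simp only [step, phase, Phase.step] <;> (try split_ifs) <;> rfl

theorem out_step (c : Conf) (s t : Option Bool) :
    (c.step s t).out = (c.phase.step s t).2.toList ++ c.out := by
  rcases c with _ | f | f | f | _ <;> rcases s with _ | s <;> rcases t with _ | t <;>
    simp only [step, phase, Phase.step] <;> (try split_ifs) <;> rfl

/-- Read two strings in parallel. -/
def scan (c : Conf) : Str → Str → Conf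
  | [], [] => c
  | s :: a, [] => scan (c.step (some s) none) a []
  | [], t :: b => scan (c.step none (some t)) [] b
  | s :: a, t :: b => scan (c.step (some s) (some t)) a b
termination_by a b => a.length + b.length

/-- The instance and the witness, if they have been read completely. -/
def result : Conf → Option (Str × Str)
  | inp _ w x => some (x, w)
  | _ => none

theorem length_out_step_le (c : Conf) (s t : Option Bool) :
    (c.step s t).out.length ≤ c.out.length + 1 := by
  rw [out_step, List.length_append, Nat.add_comm]
  exact Nat.add_le_add_left Option.length_toList_le _

theorem length_out_scan_le (c : Conf) (a b : Str) :
    (c.scan a b).out.length ≤ c.out.length + (a.length + b.length) := by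
  induction c, a, b using scan.induct with
  | case1 c => simp [scan]
  | case2 c s a ih =>
    have := c.length_out_step_le (some s) none
    rw [scan, List.length_cons]
    omega
  | case3 c t b ih =>
    have := c.length_out_step_le none (some t)
    rw [scan, List.length_cons]
    omega
  | case4 c s a t b ih =>
    have := c.length_out_step_le (some s) (some t)
    rw [scan, List.length_cons, List.length_cons]
    omega

end Conf

/-! ### A machine that reads two strings in parallel -/

section Machine

/-- The state of the machine that reads two strings in parallel. -/
abbrev ScanState : Type := Phase × Option (Option Bool) × Option (Option Bool)

/-- Read the contents of the first two auxiliary stacks in parallel. -/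
noncomputable def scanner : Frag regΓ ScanState :=
  .rep (.pop .aux₁ (fun v o => (v.1, o, v.2.2)) (.pop .aux₂ (fun v o => (v.1, v.2.1, o))
    (pushOpt .dst (fun v => (v.1.step v.2.1.join v.2.2.join).2)
      (.branch (fun v => v.2.1.isSome || v.2.2.isSome)
        (.load (fun v => ((v.1.step v.2.1.join v.2.2.join).1, v.2)) (.goto fun _ => ()))
        .halt))))

theorem runs_scanner_step (c : Conf) {a a' b b' : Str} (hab : a ≠ [] ∨ b ≠ []) (ha : a.tail = a')
    (hb : b.tail = b') (o₁ o₂ : Option (Option Bool)) {v : ScanState} {T : ∀ k, List (regΓ k)}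
    {t : ℕ} (h : ∀ o₁ o₂, scanner.Runs ((c.step a.head? b.head?).phase, o₁, o₂)
      (regStk [] (c.step a.head? b.head?).out (a'.map some) (b'.map some) []) v T t) :
    scanner.Runs (c.phase, o₁, o₂) (regStk [] c.out (a.map some) (b.map some) []) v T (t + 1) := by
  refine Frag.runs_rep_goto ?_ (h (a.head?.map some) (b.head?.map some))
  have hj : ∀ l : Str, (l.map some).head?.join = l.head? := by rintro (_ | _) <;> rfl
  have hj' : ∀ o : Option Bool, (o.map some).join = o := by rintro (_ | _) <;> rfl
  have hh : ∀ l : Str, (l.map some).head? = l.head?.map some := by rintro (_ | _) <;> rfl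
  have hor : ((a.head?.map some).isSome || (b.head?.map some).isSome) = true := by
    rcases a with _ | _ <;> rcases b with _ | _ <;> simp at hab ⊢
  have hstk : ∀ d, Function.update (Function.update
      (regStk [] d (a.map some) (b.map some) []) .aux₁ (a.map some).tail) .aux₂ (b.map some).tail =
      regStk [] d (a'.map some) (b'.map some) [] := by
    intro d
    funext k
    subst ha hb
    cases k <;> simp [regStk]
  have hb' : Function.update (regStk [] c.out (a.map some) (b.map some) []) .aux₁
      (a.map some).tail .aux₂ = b.map some := rfl
  have ha' : regStk [] c.out (a.map some) (b.map some) [] .aux₁ = a.map some := rfl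
  rw [Conf.phase_step, Conf.out_step]
  simp only [stepAux, ha', hb', hstk]
  cases he : (c.phase.step a.head? b.head?).2 with
  | none =>
    rw [stepAux_pushOpt_none (by simp only [hj]; exact he)]
    simp only [stepAux, hh, hor, cond_true, hj']
    simp
  | some y =>
    rw [stepAux_pushOpt_some (y := y) (by simp only [hj]; exact he)]
    simp only [stepAux, hh, hor, cond_true, hj']
    congr 1
    funext k
    cases k <;> simp [regStk]

/-- The machine stores only the phase; the strings collected in a `Conf` are what lies on the output
stack. For this reason a rejecting `Conf` still remembers what was emitted. -/
theorem runs_scanner (c : Conf) (a b : Str) (o₁ o₂ : Option (Option Bool)) :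
    scanner.Runs (c.phase, o₁, o₂) (regStk [] c.out (a.map some) (b.map some) [])
      ((c.scan a b).phase, none, none) (regStk [] (c.scan a b).out [] [] [])
      (a.length + b.length + 1) := by
  induction c, a, b using Conf.scan.induct generalizing o₁ o₂ with
  | case1 c =>
    rw [Conf.scan]
    -- The last pass finds both stacks empty: it emits nothing and halts before the phase is
    -- updated, so an accepting phase survives.
    have hnone : (c.phase.step none none).2 = none := by cases c <;> rfl
    refine Frag.Runs.congr (Frag.runs_rep_halt (T' := regStk [] c.out [] [] []) ?_) (fun k => ?_)
      (by simp)
    · simp only [stepAux]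
      rw [stepAux_pushOpt_none (by simpa [regStk] using hnone)]
      change Cfg.mk none (c.phase, none, none) _ = _
      congr 1
      funext k
      cases k <;> simp [regStk]
    · rfl
  | case2 c s a ih =>
    rw [Conf.scan]
    refine (runs_scanner_step c (a := s :: a) (b := []) (by simp) rfl rfl o₁ o₂ ih).mono ?_
    simp only [List.length_cons]
    omega
  | case3 c t b ih =>
    rw [Conf.scan]
    refine (runs_scanner_step c (a := []) (b := t :: b) (by simp) rfl rfl o₁ o₂ ih).mono ?_
    simp only [List.length_cons]
    omega
  | case4 c s a t b ih =>
    rw [Conf.scan]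
    refine (runs_scanner_step c (a := s :: a) (b := t :: b) (by simp) rfl rfl o₁ o₂ ih).mono ?_
    simp only [List.length_cons]
    omega

/-- Replace the output by `d` unless the phase is accepting. -/
noncomputable def orElse (d : List (Option Bool)) : Frag regΓ ScanState :=
  .rep (.branch (fun v => v.1.accepting) (.load (fun _ => (.start, none, none)) .halt)
    (.pop .dst (fun v o => (v.1, o, v.2.2)) (.branch (fun v => v.2.1.isSome) (.goto fun _ => ())
      (pushList .dst (fun _ => d.reverse) (.load (fun _ => (.start, none, none)) .halt)
        d.length))))

theorem runs_orElse_accepting (d : List (Option Bool)) {φ : Phase} (hφ : φ.accepting = true)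
    (T : ∀ k, List (regΓ k)) :
    (orElse d).Runs (φ, none, none) T (.start, none, none) T 1 :=
  Frag.runs_rep_halt (by simp [hφ])

theorem runs_orElse (d : List (Option Bool)) {φ : Phase} (hφ : φ.accepting = false)
    (l : List (Option Bool)) (o : Option (Option Bool)) :
    (orElse d).Runs (φ, o, none) (regStk [] l [] [] []) (.start, none, none)
      (regStk [] d [] [] []) (l.length + 1) := by
  induction l generalizing o with
  | nil =>
    refine Frag.runs_rep_halt ?_
    simp only [stepAux, hφ, cond_false, regStk, List.head?_nil, Option.isSome_none]
    rw [stepAux_pushList (by simp)]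
    simp only [stepAux]
    congr 1
    funext k
    cases k <;> simp [regStk]
  | cons x l ih =>
    refine Frag.runs_rep_goto ?_ (ih (some x))
    simp only [stepAux, hφ, cond_false, regStk, List.head?_cons, Option.isSome_some, cond_true]
    congr 1
    funext k
    cases k <;> simp [regStk]

end Machine

/-- The instance and the witness held by two strings of the same length. -/
def decode (a b : Str) : Option (Str × Str) := (Conf.start.scan a.reverse b.reverse).result

theorem Conf.encodePair_getD_result (c : Conf) (d : Str × Str) :
    encodePair (c.result.getD d) = if c.phase.accepting then c.out else encodePair d := by
  cases c <;> rfl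

/-- Loading the strings onto two stacks reverses both, which is the order in which `decode` reads
them. Pushing reverses once more, so instance and witness come out in their proper order. After a
rejection, the partial output is erased and replaced by `d`. -/
theorem polyTime_decode (d : Str × Str) :
    PolyTime encodePair encodePair fun y : Str × Str => (decode y.1 y.2).getD d := by
  let F₁ : Frag regΓ ScanState := splitSrc (fun v => v.2.1) fun v o => (v.1, o, v.2.2)
  let F₂ : Frag regΓ ScanState := move .src .aux₂ (fun v o => (v.1, o, v.2.2)) fun v => v.2.1
  refine PolyTime.of_frag (F₁.seq (F₂.seq (scanner.seq (orElse (encodePair d)))))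
    .src .dst (Equiv.refl (Option Bool)) (Equiv.refl (Option Bool))
    ((.start, none, none) : ScanState) (.X + 1 + (.X + 1 + (.X + .X + 1 + (.X + .X + 1))))
    (fun a => List.map_id _) (fun a => List.map_id _) fun y => ?_
  obtain ⟨a, b⟩ := y
  have s₁ : F₁.Runs (.start, none, none) (regStk (encodePair (a, b)) [] [] [] [])
      (.start, none, none) (regStk (b.map some) [] (a.map some).reverse [] [])
      (a.length + 1) := by
    refine runs_splitSrc ?_ ?_ ?_ _ _
    · exact fun _ _ _ => rfl
    · exact fun _ _ => rfl
    · rfl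
  have s₂ : F₂.Runs (.start, none, none) (regStk (b.map some) [] (a.map some).reverse [] [])
      (.start, none, none)
      (regStk [] Conf.start.out (a.reverse.map some) (b.reverse.map some) []) (b.length + 1) := by
    refine Frag.Runs.congr (runs_move (i := Reg.src) (j := Reg.aux₂) (by simp) (f := id)
      ?_ ?_ ?_ _) ?_ ?_
    · exact fun _ _ _ => rfl
    · exact fun _ _ => Option.map_id'.symm
    · rfl
    · rintro (_ | _) <;> simp [regStk, Conf.out]
    · simp [regStk]
  have s₃ := runs_scanner .start a.reverse b.reverse none none
  generalize hc : Conf.start.scan a.reverse b.reverse = c at s₃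
  have hout : c.out.length ≤ a.length + b.length := by
    rw [← hc]
    simpa [Conf.out] using Conf.start.length_out_scan_le a.reverse b.reverse
  have s₄ : (orElse (encodePair d)).Runs (c.phase, none, none) (regStk [] c.out [] [] [])
      (.start, none, none) (regStk [] (encodePair (c.result.getD d)) [] [] [])
      (c.out.length + 1) := by
    rw [c.encodePair_getD_result]
    cases h : c.phase.accepting
    · exact runs_orElse _ h _ _
    · exact (runs_orElse_accepting _ h _).mono (by omega)
  rw [funext (single_src _)]
  refine (s₁.seq (s₂.seq (s₃.seq s₄))).congr (fun k => ?_) ?_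
  · rw [single_dst, decode, hc]
  · have : a.length + b.length + 1 = (encodePair (a, b)).length := by simp [encodePair]; omega
    simp only [Polynomial.eval_add, Polynomial.eval_X, Polynomial.eval_one, List.length_reverse]
    omega

/-! ### Combinatorics of the coding -/

namespace Conf

theorem result_scan_rej (o : List (Option Bool)) (a b : Str) : ((rej o).scan a b).result = none := by
  induction hn : a.length + b.length using Nat.strong_induction_on generalizing o a b with
  | _ n ih =>
    rcases a with _ | ⟨s, a⟩ <;> rcases b with _ | ⟨t, b⟩ <;> rw [scan]
    · rfl
    all_goals
      refine ih _ ?_ _ _ _ rfl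
      rw [← hn]
      simp only [List.length_cons, List.length_nil]
      omega

/-- Once one string is exhausted before the other, the scan rejects, and rejection is permanent. -/
theorem length_eq_of_result_scan {c : Conf} {a b : Str} {r : Str × Str}
    (h : (c.scan a b).result = some r) : a.length = b.length := by
  induction a generalizing b c with
  | nil =>
    rcases b with _ | ⟨t, b⟩
    · rfl
    · have : c.step none (some t) = rej c.out := by cases c <;> rfl
      simp [scan, this, result_scan_rej] at h
  | cons s a ih =>
    rcases b with _ | ⟨t, b⟩
    · have : c.step (some s) none = rej c.out := by cases c <;> rfl
      simp [scan, this, result_scan_rej] at h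
    · rw [scan] at h
      simp [ih h]

/-- Exchange the roles of the two strings. -/
def swap : Conf → Conf
  | start => start
  | pad f => pad !f
  | wit f w => wit (!f) w
  | inp f w x => inp (!f) w x
  | rej o => rej o

theorem step_swap (c : Conf) (s t : Option Bool) : c.swap.step t s = (c.step s t).swap := by
  rcases c with _ | f | f | f | _ <;> rcases s with _ | s <;> rcases t with _ | t
  case start.some.some => cases s <;> cases t <;> rfl
  case pad.some.some => cases f <;> cases s <;> cases t <;> rfl
  case wit.some.some => cases f <;> cases s <;> cases t <;> rfl
  case inp.some.some => cases f <;> rfl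
  all_goals rfl

theorem scan_swap (c : Conf) (a b : Str) : c.swap.scan b a = (c.scan a b).swap := by
  induction c, a, b using scan.induct with
  | case1 c => rw [scan, scan]
  | case2 c s a ih => rw [scan, scan, step_swap, ih]
  | case3 c t b ih => rw [scan, scan, step_swap, ih]
  | case4 c s a t b ih => rw [scan, scan, step_swap, ih]

theorem result_swap (c : Conf) : c.swap.result = c.result := by cases c <;> rfl

theorem scan_inp {w x a b : Str} {r : Str × Str}
    (h : ((inp false w x).scan a b).result = some r) : r = (a.reverse ++ x, w) := by
  have hl := length_eq_of_result_scan h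
  induction a generalizing b x with
  | nil =>
    rcases b with _ | ⟨t, b⟩
    · simpa [scan, result, eq_comm] using h
    · simp at hl
  | cons s a ih =>
    rcases b with _ | ⟨t, b⟩
    · simp at hl
    · rw [scan] at h
      simpa using ih h (by simpa using hl)

/-- Each of the `j` zeros admits one more witness symbol, and the `true` after them ends the
witness. -/
theorem scan_wit {w a b : Str} {j : ℕ} {r : Str × Str}
    (h : ((wit false w).scan (List.replicate j false ++ true :: a) b).result = some r) :
    r.1 = a.reverse ∧ r.2.length = w.length + j := by
  have hl := length_eq_of_result_scan h
  induction j generalizing b w with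
  | zero =>
    rcases b with _ | ⟨t, b⟩
    · simp at hl
    · rw [List.replicate_zero, List.nil_append, scan] at h
      simp [scan_inp (a := a) (b := b) h]
  | succ j ih =>
    rcases b with _ | ⟨t, b⟩
    · simp at hl
    · rw [List.replicate_succ, List.cons_append, scan] at h
      obtain ⟨h₁, h₂⟩ := ih (w := t :: w) h (by simp at hl ⊢; omega)
      refine ⟨h₁, ?_⟩
      rw [h₂, List.length_cons]
      omega

/-- The partner's mark that ends the padding stands opposite one of the `j` zeros, so fewer than `j`
are left for the witness. -/
theorem scan_pad {a b : Str} {j : ℕ} {r : Str × Str}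
    (h : ((pad false).scan (List.replicate j false ++ true :: a) b).result = some r) :
    r.1 = a.reverse ∧ r.2.length < j := by
  have hl := length_eq_of_result_scan h
  induction j generalizing b with
  | zero =>
    rcases b with _ | ⟨t, b⟩
    · simp at hl
    · rw [List.replicate_zero, List.nil_append, scan] at h
      rw [show (pad false).step (some true) (some t) = rej [] from rfl, result_scan_rej] at h
      cases h
  | succ j ih =>
    rcases b with _ | ⟨_ | _, b⟩
    · simp at hl
    · rw [List.replicate_succ, List.cons_append, scan] at h
      obtain ⟨h₁, h₂⟩ := ih h (by simp at hl ⊢; omega)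
      exact ⟨h₁, by omega⟩
    · rw [List.replicate_succ, List.cons_append, scan] at h
      obtain ⟨h₁, h₂⟩ := scan_wit (w := []) h
      exact ⟨h₁, by simp [h₂]⟩

theorem scan_pad_replicate (i : ℕ) (a b : Str) :
    (pad false).scan (List.replicate i false ++ a) (List.replicate i false ++ b) =
      (pad false).scan a b := by
  induction i with
  | zero => rfl
  | succ i ih =>
    rw [List.replicate_succ, List.cons_append, List.cons_append, scan]
    exact ih

theorem scan_wit_replicate (l w a b : Str) :
    (wit false w).scan (List.replicate l.length false ++ a) (l ++ b) =
      (wit false (l.reverse ++ w)).scan a b := by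
  induction l generalizing w with
  | nil => rfl
  | cons t l ih =>
    rw [List.length_cons, List.replicate_succ, List.cons_append, List.cons_append, scan]
    rw [List.reverse_cons, List.append_assoc]
    exact ih (t :: w)

theorem scan_inp_self (w x a : Str) :
    (inp false w x).scan a a = inp false w (a.reverse ++ x) := by
  induction a generalizing x with
  | nil => simp [scan]
  | cons s a ih =>
    rw [scan]
    rw [List.reverse_cons, List.append_assoc]
    exact ih (s :: x)

end Conf

theorem decode_comm (a b : Str) : decode a b = decode b a := by
  rw [decode, decode, ← Conf.result_swap, ← Conf.scan_swap]
  rfl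

theorem length_eq_of_decode {a b : Str} {r : Str × Str} (h : decode a b = some r) :
    a.length = b.length := by
  simpa using Conf.length_eq_of_result_scan h

theorem decode_nil_right (a : Str) : decode a [] = none := by
  cases h : decode a [] with
  | none => rfl
  | some r =>
    obtain rfl : a = [] := by simpa using length_eq_of_decode h
    simp [decode, Conf.scan, Conf.result] at h

/-- A string that holds an instance and leaves room for witnesses of length at most `n`. -/
def holdInstance (n : ℕ) (x : Str) : Str := x ++ true :: List.replicate (n + 2) false

theorem reverse_holdInstance (n : ℕ) (x : Str) :
    (holdInstance n x).reverse = false :: (List.replicate (n + 1) false ++ true :: x.reverse) := by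
  rw [← List.cons_append, ← List.replicate_succ]
  simp [holdInstance]

/-- Of the `n + 2` zeros, one announces the role and one faces the partner's mark, which leaves at
most `n` for the witness. -/
theorem decode_holdInstance {n : ℕ} {x b : Str} {r : Str × Str}
    (h : decode (holdInstance n x) b = some r) : r.1 = x ∧ r.2.length ≤ n := by
  have hl := length_eq_of_decode h
  rw [decode, reverse_holdInstance] at h
  rcases hb : b.reverse with _ | ⟨_ | _, b'⟩ <;> rw [hb] at h
  · simp [List.reverse_eq_nil_iff.1 hb, holdInstance] at hl
  · rw [Conf.scan, show Conf.start.step (some false) (some false) = .rej [] from rfl,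
      Conf.result_scan_rej] at h
    cases h
  · rw [Conf.scan] at h
    obtain ⟨h₁, h₂⟩ := Conf.scan_pad h
    exact ⟨by simpa using h₁, by omega⟩

theorem exists_decode_holdInstance {n : ℕ} {w : Str} (hw : w.length ≤ n) (x : Str) :
    ∃ b, decode (holdInstance n x) b = some (x, w) := by
  -- Read backwards, the partner shows its role bit, padding, the mark and the witness reversed. The
  -- final `true :: x.reverse` is never used; it only equalizes the lengths.
  refine ⟨(true :: (List.replicate (n - w.length) false ++
    true :: (w.reverse ++ true :: x.reverse))).reverse, ?_⟩
  rw [decode, reverse_holdInstance, List.reverse_reverse, Conf.scan]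
  have h₁ : List.replicate (n + 1) false ++ true :: x.reverse =
      List.replicate (n - w.length) false ++
        false :: (List.replicate w.reverse.length false ++ true :: x.reverse) := by
    rw [show n + 1 = (n - w.length) + (w.reverse.length + 1) by
      rw [List.length_reverse]; omega, ← List.replicate_append_replicate, List.append_assoc,
      List.replicate_succ]
    rfl
  have h₂ := Conf.scan_pad_replicate (n - w.length)
    (false :: (List.replicate w.reverse.length false ++ true :: x.reverse))
    (true :: (w.reverse ++ true :: x.reverse))
  rw [← h₁, Conf.scan] at h₂
  refine (congrArg Conf.result h₂).trans ?_
  have h₃ := Conf.scan_wit_replicate w.reverse [] (true :: x.reverse) (true :: x.reverse)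
  refine (congrArg Conf.result h₃).trans ?_
  rw [Conf.scan]
  refine (congrArg Conf.result (Conf.scan_inp_self _ _ _)).trans ?_
  simp [Conf.result]

/-! ### Polynomial-time ingredients of the reduction -/

theorem polyTime_holdInstance (p : Polynomial ℕ) :
    PolyTime id id fun x : Str => holdInstance (p.eval x.length) x := by
  -- A transducer turns the delimiter into `true` and appends two zeros to the unary value of `p`.
  have h : PolyTime encodePair id fun y : Str × Str => y.1 ++ true :: (y.2 ++ [false, false]) := by
    refine .of_transduce (Q := Unit) (fun _ _ => ()) (fun _ o => [o.getD true])
      (fun _ => [false, false]) () ?_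
    rintro ⟨a, b⟩
    have hb : transduce (fun _ _ => ()) (fun _ (o : Option Bool) => [o.getD true])
        (fun _ => [false, false]) () (b.map some) = b ++ [false, false] := by
      induction b with
      | nil => rfl
      | cons t b ih => exact congrArg (t :: ·) ih
    induction a with
    | nil => exact congrArg (true :: ·) hb.symm
    | cons s a ih => exact congrArg (s :: ·) ih
  convert h.comp (polyTime_pair_unary p) using 3 with x
  simp [holdInstance, ← List.replicate_append_replicate]

theorem PolyTime.to_id {α β A B : Type} {ea : α → List A} {eb : β → List B} {f : α → β}
    (h : PolyTime ea eb f) : PolyTime ea id fun a => eb (f a) := by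
  obtain ⟨⟨aux, t, h⟩⟩ := h
  exact ⟨⟨aux, t, h⟩⟩

theorem polyTime_fst : PolyTime encodePair id fun y : Str × Str => y.1 := by
  refine .of_transduce (Q := Bool) (fun q o => q && o.isSome)
    (fun q o => bif q then o.toList else []) (fun _ => []) true ?_
  rintro ⟨a, b⟩
  have hb : transduce (fun q (o : Option Bool) => q && o.isSome)
      (fun q (o : Option Bool) => bif q then o.toList else []) (fun _ => []) false
      (b.map some) = [] := by
    induction b with
    | nil => rfl
    | cons t b ih => exact ih
  induction a with
  | nil => exact hb.symm
  | cons s a ih => exact congrArg (s :: ·) ih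

theorem P_subset_NP : P ⊆ NP := by
  rintro L ⟨f, hf, hL⟩
  refine ⟨fun y => f y.1, 0, hf.comp polyTime_fst, fun x => ?_⟩
  rw [hL]
  exact ⟨fun h => ⟨[], by simp, h⟩, fun ⟨_, _, h⟩ => h⟩

theorem polyTime_pair_true : PolyTime id encodePair fun a : Str => (a, [true]) := by
  refine .of_transduce (Q := Unit) (fun _ _ => ()) (fun _ b => [some b])
    (fun _ => [none, some true]) () fun a => ?_
  induction a with
  | nil => rfl
  | cons s a ih => exact congrArg (_ :: ·) ih

/-- An arbitrary table `c` is admissible, since its two entries are built into the final output of a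
transducer. -/
theorem polyTime_of_head (c : Bool → Str × Str) :
    PolyTime id encodePair fun z : Str => c (z.head?.getD false) := by
  refine .of_transduce (Q := Option Bool) (fun q b => q <|> some b) (fun _ _ => [])
    (fun q => encodePair (c (q.getD false))) none fun z => ?_
  have h : ∀ b (z : Str), transduce (fun q b => q <|> some b) (fun _ _ => [])
      (fun q => encodePair (c (q.getD false))) (some b) z = encodePair (c b) := by
    intro b z
    induction z with
    | nil => rfl
    | cons t z ih => exact ih
  rcases z with _ | ⟨b, z⟩
  · rfl
  · exact (h b z).symm

/-! ### The function -/

/-- Whether the two strings together hold an instance and a witness accepted by `V`. -/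
def checkPair (V : Str × Str → Bool) (a b : Str) : Str :=
  [((decode a b).map V).getD false]

section

variable {V : Str × Str → Bool}

theorem checkPair_comm (a b : Str) : checkPair V a b = checkPair V b a := by
  rw [checkPair, checkPair, decode_comm]

theorem checkPair_eq_true {a b : Str} :
    checkPair V a b = [true] ↔ ∃ r, decode a b = some r ∧ V r = true := by
  cases h : decode a b <;> simp [checkPair, h]

/-- The table chooses a preimage of each attained bit; no computation of it is needed. An unattained
bit gets a dummy entry. -/
theorem exists_preimages (V : Str × Str → Bool) : ∃ c : Bool → Str × Str, ∀ a b,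
    ∃ v, checkPair V a b = [v] ∧ checkPair V (c v).1 (c v).2 = [v] := by
  have : ∀ v, ∃ y : Str × Str, (∃ a b, checkPair V a b = [v]) → checkPair V y.1 y.2 = [v] := by
    intro v
    by_cases h : ∃ a b, checkPair V a b = [v]
    · obtain ⟨a, b, h⟩ := h
      exact ⟨(a, b), fun _ => h⟩
    · exact ⟨([], []), fun h' => absurd h' h⟩
  choose c hc using this
  exact ⟨c, fun a b => ⟨_, rfl, hc _ ⟨a, b, rfl⟩⟩⟩

theorem honest_checkPair (V : Str × Str → Bool) : Honest (checkPair V) := by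
  obtain ⟨c, hc⟩ := exists_preimages V
  let n : Bool → ℕ := fun v => (c v).1.length + (c v).2.length
  refine ⟨.C (n true + n false), ?_⟩
  rintro _ ⟨a, b, rfl⟩
  obtain ⟨v, h, hv⟩ := hc a b
  refine ⟨_, _, ?_, hv.trans h.symm⟩
  rw [Polynomial.eval_C]
  cases v
  · exact Nat.le_add_left _ _
  · exact Nat.le_add_right _ _

theorem invertible_checkPair (V : Str × Str → Bool) : Invertible (checkPair V) := by
  obtain ⟨c, hc⟩ := exists_preimages V
  refine ⟨_, polyTime_of_head c, ?_⟩
  rintro _ ⟨a, b, rfl⟩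
  obtain ⟨v, h, hv⟩ := hc a b
  rw [h]
  exact hv

/-- A partner that decodes has the same length as the given argument; one that does not can be
replaced by the empty string. -/
theorem sHonest_checkPair (V : Str × Str → Bool) : SHonest (checkPair V) := by
  have key : ∀ a b, ∃ b', b'.length ≤ a.length ∧ checkPair V a b' = checkPair V a b := by
    intro a b
    cases h : decode a b with
    | none => exact ⟨[], by simp, by rw [checkPair, checkPair, decode_nil_right, h]⟩
    | some r => exact ⟨b, (length_eq_of_decode h).ge, rfl⟩
  refine ⟨.X, ?_, ?_⟩
  · rintro _ a ⟨b, rfl⟩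
    obtain ⟨b', hb, h⟩ := key a b
    exact ⟨b', by rw [Polynomial.eval_X]; omega, h⟩
  · rintro _ b ⟨a, rfl⟩
    obtain ⟨a', ha, h⟩ := key b a
    exact ⟨a', by rw [Polynomial.eval_X]; omega, by rw [checkPair_comm, h, checkPair_comm]⟩

/-- A failed decoding is replaced by a pair `d` that `V` rejects, so that `V` can be applied
unconditionally. -/
theorem polyTime_getD_decode (hV : PolyTime encodePair Computability.encodeBool V) {d : Str × Str}
    (hd : V d = false) : PolyTime encodePair Computability.encodeBool
      fun y : Str × Str => ((decode y.1 y.2).map V).getD false := by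
  convert hV.comp (polyTime_decode d) using 2 with y
  cases decode y.1 y.2 <;> simp [hd]

/-- To decide `x`, ask the inverter for a partner of `A x` with value `[true]`, and check its
answer. Checking makes the answer sound, since an inverter may return anything when no partner
exists. -/
theorem mem_P_of_invertibleFst {L : Language Bool} {p : Polynomial ℕ}
    (hV : PolyTime encodePair Computability.encodeBool V)
    (hL : ∀ x, x ∈ L ↔ ∃ w : Str, w.length ≤ p.eval x.length ∧ V (x, w) = true) {d : Str × Str}
    (hd : V d = false) (h : InvertibleFst (checkPair V)) : L ∈ P := by
  obtain ⟨g, hg, hinv⟩ := h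
  let A : Str → Str := fun x => holdInstance (p.eval x.length) x
  refine ⟨fun x => ((decode (A x) (g (A x, [true]))).map V).getD false,
    ((polyTime_getD_decode hV hd).comp (hg.comp polyTime_pair_true).pair).comp
      (polyTime_holdInstance p), fun x => ?_⟩
  have hx : ((decode (A x) (g (A x, [true]))).map V).getD false = true ↔
      checkPair V (A x) (g (A x, [true])) = [true] := by
    rw [checkPair, List.cons.injEq, and_iff_left rfl]
  rw [hL, hx]
  constructor
  · rintro ⟨w, hw, hVw⟩
    obtain ⟨b, hb⟩ := exists_decode_holdInstance hw x
    exact hinv _ _ b (checkPair_eq_true.2 ⟨_, hb, hVw⟩)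
  · intro h
    obtain ⟨⟨x', w⟩, hr, hVr⟩ := checkPair_eq_true.1 h
    obtain ⟨rfl, hw⟩ := decode_holdInstance hr
    exact ⟨w, hw, hVr⟩

theorem InvertibleSnd.invertibleFst (h : InvertibleSnd (checkPair V)) :
    InvertibleFst (checkPair V) := by
  obtain ⟨g, hg, h⟩ := h
  refine ⟨g, hg, fun z a b hab => ?_⟩
  rw [checkPair_comm]
  exact h z b a (by rw [checkPair_comm, hab])

end

end StrongOneWay

theorem theorem3p2 (h : StrongOneWay.P ≠ StrongOneWay.NP) :
    ∃ σ : StrongOneWay.Str → StrongOneWay.Str → StrongOneWay.Str,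
      StrongOneWay.Honest σ ∧ StrongOneWay.StronglyOneWay σ ∧
      StrongOneWay.Invertible σ ∧ ¬ StrongOneWay.OneWay σ := by
  open StrongOneWay in
  obtain ⟨L, ⟨V, p, hV, hL⟩, hLP⟩ := Set.exists_of_ssubset (P_subset_NP.ssubset_of_ne h)
  -- If `V` accepted every pair, the language would contain all strings and so lie in P.
  obtain ⟨d, hd⟩ : ∃ d, V d = false := by
    by_contra! hall
    have h₁ : PolyTime (id : Str → Str) Computability.encodeBool fun _ => true :=
      .of_transduce (Q := Unit) (fun _ _ => ()) (fun _ _ => []) (fun _ => [true]) () fun a => by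
        induction a with
        | nil => rfl
        | cons s a ih => exact ih
    refine hLP ⟨_, h₁, fun x => ?_⟩
    rw [hL]
    exact iff_of_true ⟨[], by simp, by simpa using hall (x, [])⟩ rfl
  have hfst : ¬ InvertibleFst (checkPair V) := fun h => hLP (mem_P_of_invertibleFst hV hL hd h)
  have hinv := invertible_checkPair V
  exact ⟨checkPair V, honest_checkPair V,
    ⟨sHonest_checkPair V, (polyTime_getD_decode hV hd).to_id, hfst,
      fun h => hfst h.invertibleFst⟩, hinv, fun h => h.2.2 hinv⟩
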